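/- **Setting.** Let $m>0$ and $\hbar,q,\mu''\in\mathbb R$, and let $\mathbf E,\mathbf B\in\mathbb R^3$ be constant. Let $\phi=\phi_0+\varepsilon\phi_1$ and $\mathbf A=\mathbf A_0+\varepsilon\mathbf A_1$ be smooth time-independent real potentials on $\mathbb R^3$ with $-\nabla\phi=\varepsilon\mathbf E$ and $\nabla\times\mathbf A=\varepsilon\mathbf B$, where $\varepsilon$ is a formal real parameter with $\varepsilon^2=0$ ("linear order in $F_{\mu\nu}$"; the fields below stand for $\varepsilon\mathbf E$, $\varepsilon\mathbf B$). Operators act on $C_c^\infty(\mathbb R^3;\mathbb C^2)$, $\dagger$ is the formal $L^2$-adjoint, and operators are formal Laurent series in $1/c$ whose coefficients are of the form $T_0+\varepsilon T_1$, with $T_0,T_1$ linear operators having a formal adjoint. The positive square root of such a series is the unique one with positive real leading coefficient. Put $\mathbf p=-i\hbar\nabla$, $\boldsymbol\pi=\mathbf p-\frac qc\mathbf A$, $\mu'=\mu''/c$, $\gamma_{\boldsymbol\pi}=\sqrt{1+(\boldsymbol\pi/(mc))^2}$, let $\boldsymbol\sigma$ be the Pauli matrices, $\beta=\begin{pmatrix}1&0\\0&-1\end{pmatrix}$,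 $\boldsymbol\alpha=\begin{pmatrix}0&\boldsymbol\sigma\\\boldsymbol\sigma&0\end{pmatrix}$, $\boldsymbol\Sigma=\begin{pmatrix}\boldsymbol\sigma&0\\0&\boldsymbol\sigma\end{pmatrix}$, and $$\tilde H=mc^2\beta+c\,\boldsymbol\alpha\cdot\boldsymbol\pi+q\phi,\qquad \tilde{\mathcal H}=\tilde H+\mu'\left(-\beta\boldsymbol\Sigma\cdot\mathbf B+i\beta\boldsymbol\alpha\cdot\mathbf E\right)$$ (the Dirac and the Dirac–Pauli Hamiltonian). For a series $X=\sum_{j\ge1}X_jc^{-j}$ let $Y=(1+X^\dagger X)^{-1/2}$, $Z=(1+XX^\dagger)^{-1/2}$ and $U_X=\begin{pmatrix}Y&YX^\dagger\\-ZX&Z\end{pmatrix}$. **Theorem.** The positive square roots $\gamma_{\boldsymbol\pi}$ and $\sqrt{m^2c^4+c^2\boldsymbol\pi^2}$ exist. There is exactly one $X=\sum_{j\ge1}X_jc^{-j}$ such that $U_X\tilde HU_X^\dagger$ is block-diagonal, and exactly one $\mathcal X=\sum_{j\ge1}\mathcal X_jc^{-j}$ such that $U_{\mathcal X}\tilde{\mathcal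 H}U_{\mathcal X}^\dagger$ is block-diagonal; $U_X$ and $U_{\mathcal X}$ are unitary. Let $H_{\rm FW}$ and $\mathcal H_{\rm FW}$ be the upper left blocks of the transformed Hamiltonians. The following equalities hold exactly, to linear order in the fields and to all orders in $1/c$. 1. (Dirac) $$H_{\rm FW}=q\phi+\sqrt{m^2c^4+c^2\boldsymbol\pi^2}-\frac{q\hbar}{2mc}\frac1{\gamma_{\boldsymbol\pi}}\boldsymbol\sigma\cdot\mathbf B+\frac{q\hbar}{2mc}\left(\frac1{\gamma_{\boldsymbol\pi}}-\frac1{1+\gamma_{\boldsymbol\pi}}\right)\boldsymbol\sigma\cdot\left(\frac{\boldsymbol\pi}{mc}\times\mathbf E\right).$$ 2. (Dirac–Pauli) $$\mathcal H_{\rm FW}=\sqrt{m^2c^4+c^2\boldsymbol\pi^2}+q\phi-\boldsymbol\sigma\cdot\left[\left(\mu'+\frac{q\hbar}{2mc}\frac1{\gamma_{\boldsymbol\pi}}\right)\mathbf B-\mu'\frac1{\gamma_{\boldsymbol\pi}(1+\gamma_{\boldsymbol\pi})}\left(\frac{\boldsymbol\pi}{mc}\cdot\mathbf B\right)\frac{\boldsymbol\pi}{mc}-\left(\mu'\frac1{\gamma_{\boldsymbol\pi}}+\frac{q\hbar}{2mc}\frac1{\gamma_{\boldsymbol\pi}(1+\gamma_{\boldsymbol\pi})}\right)\left(\frac{\boldsymbol\pi}{mc}\times\mathbf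 E\right)\right].$$ 3. (Classical correspondence) Let $H_{\rm cl}(\mathbf s,\gamma_m')=\sqrt{m^2c^4+c^2\boldsymbol\pi^2}+q\phi+H_{\rm spin}$ be the classical orbital plus Thomas–Bargmann–Michel–Telegdi spin Hamiltonian, with $$H_{\rm spin}=-\mathbf s\cdot\left[\left(\gamma_m'+\frac q{mc}\frac1{\gamma_{\boldsymbol\pi}}\right)\mathbf B-\gamma_m'\frac1{\gamma_{\boldsymbol\pi}(1+\gamma_{\boldsymbol\pi})}\left(\frac{\boldsymbol\pi}{mc}\cdot\mathbf B\right)\frac{\boldsymbol\pi}{mc}-\left(\gamma_m'\frac1{\gamma_{\boldsymbol\pi}}+\frac q{mc}\frac1{\gamma_{\boldsymbol\pi}(1+\gamma_{\boldsymbol\pi})}\right)\left(\frac{\boldsymbol\pi}{mc}\times\mathbf E\right)\right].$$ With the operators above in place of the classical variables, $H_{\rm FW}=H_{\rm cl}(\tfrac\hbar2\boldsymbol\sigma,0)$, and $\mathcal H_{\rm FW}=H_{\rm cl}(\tfrac\hbar2\boldsymbol\sigma,\gamma_m')$ whenever $\mu'=\tfrac\hbar2\gamma_m'$ with $\gamma_m'=g/c$,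 $g\in\mathbb R$. 4. (Antihermitian parts) $\mathcal H_{\rm FW}=H_{\rm FW}+H'_{\rm FW}$ with $H'_{\rm FW}=c\,\boldsymbol\sigma\cdot\boldsymbol\pi\,(\mathcal X-X)-\mu'\boldsymbol\sigma\cdot\mathbf B+i\mu'\,\boldsymbol\sigma\cdot\mathbf E\,X$, and the antihermitian parts of $H_{\rm FW}$, $H'_{\rm FW}$ and $\mathcal H_{\rm FW}$ are all zero. -/

import Mathlib

open scoped ContDiff

namespace DiracPauli

noncomputable section

/-! ## Wave functions and operators with a formal adjoint -/

/-- Physical space `ℝ³`. -/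
abbrev Space := EuclideanSpace ℝ (Fin 3)

/-- Two-component spinors. -/
abbrev Spinor := EuclideanSpace ℂ (Fin 2)

/-- Smooth compactly supported two-component wave functions on `ℝ³`. -/
def waveSubmodule : Submodule ℂ (Space → Spinor) where
  carrier := {ψ | ContDiff ℝ ∞ ψ ∧ HasCompactSupport ψ}
  add_mem' := fun ha hb => ⟨ha.1.add hb.1, ha.2.add hb.2⟩
  zero_mem' := ⟨contDiff_const, HasCompactSupport.zero⟩
  smul_mem' := fun c _ h => ⟨contDiff_const.smul h.1, h.2.smul_left (f := fun _ => c)⟩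

/-- The space of smooth compactly supported two-component wave functions on `ℝ³`. -/
def WaveFn : Type := waveSubmodule

instance : AddCommGroup WaveFn := inferInstanceAs (AddCommGroup waveSubmodule)
instance : Module ℂ WaveFn := inferInstanceAs (Module ℂ waveSubmodule)

/-- The `L²` inner product `∫ ψ†(x) χ(x) d³x`. -/
def ip (ψ χ : WaveFn) : ℂ := ∫ x : Space, inner ℂ (ψ.1 x) (χ.1 x)

theorem ip_integrable (ψ χ : WaveFn) :
    MeasureTheory.Integrable fun x : Space => inner ℂ (ψ.1 x) (χ.1 x) := by
  apply Continuous.integrable_of_hasCompactSupport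
  · exact ψ.2.1.continuous.inner χ.2.1.continuous
  · refine ψ.2.2.mono ?_
    intro x hx h
    apply hx
    simp [h]

theorem ip_conj (ψ χ : WaveFn) : (starRingEnd ℂ) (ip ψ χ) = ip χ ψ := by
  unfold ip
  rw [← integral_conj]
  simp

theorem ip_add_left (ψ₁ ψ₂ χ : WaveFn) : ip (ψ₁ + ψ₂) χ = ip ψ₁ χ + ip ψ₂ χ := by
  unfold ip
  rw [← MeasureTheory.integral_add (ip_integrable _ _) (ip_integrable _ _)]
  exact congrArg _ (funext fun x => inner_add_left _ _ _)

theorem ip_add_right (ψ χ₁ χ₂ : WaveFn) : ip ψ (χ₁ + χ₂) = ip ψ χ₁ + ip ψ χ₂ := by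
  unfold ip
  rw [← MeasureTheory.integral_add (ip_integrable _ _) (ip_integrable _ _)]
  exact congrArg _ (funext fun x => inner_add_right _ _ _)

theorem ip_smul_left (z : ℂ) (ψ χ : WaveFn) : ip (z • ψ) χ = (starRingEnd ℂ) z * ip ψ χ := by
  unfold ip
  rw [← MeasureTheory.integral_const_mul]
  exact congrArg _ (funext fun x => inner_smul_left _ _ _)

theorem ip_smul_right (z : ℂ) (ψ χ : WaveFn) : ip ψ (z • χ) = z * ip ψ χ := by
  unfold ip
  rw [← MeasureTheory.integral_const_mul]
  exact congrArg _ (funext fun x => inner_smul_right _ _ _)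

theorem eq_zero_of_ip_self (ψ : WaveFn) (h : ip ψ ψ = 0) : ψ = 0 := by
  by_contra hne
  have hx : ∃ x, ψ.1 x ≠ 0 := by
    by_contra hall
    push Not at hall
    exact hne (Subtype.ext (funext hall))
  obtain ⟨x, hx⟩ := hx
  have hpos : 0 < ∫ y : Space, ‖ψ.1 y‖ ^ 2 := by
    apply Continuous.integral_pos_of_hasCompactSupport_nonneg_nonzero (x := x)
    · exact ψ.2.1.continuous.norm.pow 2
    · refine ψ.2.2.mono ?_
      intro y hy h0
      apply hy
      simp [h0]
    · intro y
      positivity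
    · simpa using hx
  have : ip ψ ψ = ((∫ y : Space, ‖ψ.1 y‖ ^ 2 : ℝ) : ℂ) := by
    unfold ip
    rw [← integral_complex_ofReal]
    congr 1
    funext y
    rw [inner_self_eq_norm_sq_to_K]
    norm_cast
  rw [this] at h
  exact hpos.ne' (by exact_mod_cast h)

theorem ext_ip_left {ψ χ : WaveFn} (h : ∀ ξ, ip ξ ψ = ip ξ χ) : ψ = χ := by
  have h0 : ip (ψ + (-1 : ℂ) • χ) (ψ + (-1 : ℂ) • χ) = 0 := by
    rw [ip_add_right, ip_smul_right, h]
    ring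
  have := eq_zero_of_ip_self _ h0
  have e : ((-1 : ℂ) • χ : WaveFn) = -χ := neg_one_smul ℂ χ
  rw [e] at this
  exact add_neg_eq_zero.mp this

/-- `S` is a formal adjoint of `T`. -/
def IsAdj (T S : Module.End ℂ WaveFn) : Prop := ∀ ψ χ, ip (T ψ) χ = ip ψ (S χ)

theorem IsAdj.unique {T S S' : Module.End ℂ WaveFn} (h : IsAdj T S) (h' : IsAdj T S') :
    S = S' := by
  apply LinearMap.ext
  intro χ
  apply ext_ip_left
  intro ξ
  rw [← h, ← h']

theorem IsAdj.symm {T S : Module.End ℂ WaveFn} (h : IsAdj T S) : IsAdj S T := by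
  intro ψ χ
  rw [← ip_conj, ← h, ip_conj]

/-- The algebra of linear operators on wave functions that have a formal adjoint. -/
def opSubalgebra : Subalgebra ℂ (Module.End ℂ WaveFn) where
  carrier := {T | ∃ S, IsAdj T S}
  mul_mem' := by
    rintro T₁ T₂ ⟨S₁, h₁⟩ ⟨S₂, h₂⟩
    refine ⟨S₂ * S₁, fun ψ χ => ?_⟩
    rw [Module.End.mul_apply, Module.End.mul_apply, h₁, h₂]
  add_mem' := by
    rintro T₁ T₂ ⟨S₁, h₁⟩ ⟨S₂, h₂⟩
    refine ⟨S₁ + S₂, fun ψ χ => ?_⟩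
    rw [LinearMap.add_apply, LinearMap.add_apply, ip_add_left, ip_add_right, h₁, h₂]
  algebraMap_mem' := by
    intro z
    refine ⟨algebraMap ℂ _ ((starRingEnd ℂ) z), fun ψ χ => ?_⟩
    rw [Module.algebraMap_end_apply, Module.algebraMap_end_apply, ip_smul_left, ip_smul_right]

/-- Linear operators on wave functions that have a formal adjoint. -/
def Op : Type := opSubalgebra

instance : Ring Op := inferInstanceAs (Ring opSubalgebra)
instance : Algebra ℂ Op := inferInstanceAs (Algebra ℂ opSubalgebra)

/-- The formal adjoint `T†`. -/
instance : Star Op where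
  star T := ⟨T.2.choose, T.1, T.2.choose_spec.symm⟩

theorem isAdj_star (T : Op) : IsAdj T.1 (star T).1 := T.2.choose_spec

theorem star_eq_of_isAdj {T S : Op} (h : IsAdj T.1 S.1) : star T = S :=
  Subtype.ext ((isAdj_star T).unique h)

instance : StarRing Op where
  star_involutive T := star_eq_of_isAdj (isAdj_star T).symm
  star_mul T₁ T₂ := star_eq_of_isAdj fun ψ χ => by
    change ip (T₁.1 (T₂.1 ψ)) χ = ip ψ ((star T₂).1 ((star T₁).1 χ))
    rw [isAdj_star T₁, isAdj_star T₂]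
  star_add T₁ T₂ := star_eq_of_isAdj fun ψ χ => by
    change ip (T₁.1 ψ + T₂.1 ψ) χ = ip ψ ((star T₁).1 χ + (star T₂).1 χ)
    rw [ip_add_left, ip_add_right, isAdj_star T₁, isAdj_star T₂]

/-- The partial derivative `∂_i f`. -/
def pd {V : Type*} [NormedAddCommGroup V] [NormedSpace ℝ V] (i : Fin 3) (f : Space → V) :
    Space → V :=
  fun x => fderiv ℝ f x (EuclideanSpace.single i 1)

/-- `∂_i` on wave functions. -/
def derivEnd (i : Fin 3) : Module.End ℂ WaveFn where
  toFun ψ := ⟨pd i ψ.1, (ψ.2.1.fderiv_right (m := ∞) (by simp)).clm_apply contDiff_const,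
    ψ.2.2.fderiv_apply (𝕜 := ℝ) _⟩
  map_add' ψ χ := by
    apply Subtype.ext
    funext x
    have h₁ : DifferentiableAt ℝ ψ.1 x := ψ.2.1.differentiable (by simp) x
    have h₂ : DifferentiableAt ℝ χ.1 x := χ.2.1.differentiable (by simp) x
    change fderiv ℝ (ψ.1 + χ.1) x _ = fderiv ℝ ψ.1 x _ + fderiv ℝ χ.1 x _
    rw [fderiv_add h₁ h₂]
    rfl
  map_smul' z ψ := by
    apply Subtype.ext
    funext x
    have h₁ : DifferentiableAt ℝ ψ.1 x := ψ.2.1.differentiable (by simp) x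
    change fderiv ℝ (z • ψ.1) x _ = z • fderiv ℝ ψ.1 x _
    rw [fderiv_const_smul h₁]
    rfl

theorem ip_deriv (i : Fin 3) (ψ χ : WaveFn) : ip (derivEnd i ψ) χ = -ip ψ (derivEnd i χ) := by
  have hB : IsBoundedBilinearMap ℝ fun p : Spinor × Spinor => inner ℂ p.1 p.2 :=
    isBoundedBilinearMap_inner
  have key := integral_bilinear_fderiv_right_eq_neg_left_of_integrable
    (μ := (MeasureTheory.volume : MeasureTheory.Measure Space))
    (f := ψ.1) (g := χ.1) (v := EuclideanSpace.single i 1) (B := hB.toContinuousLinearMap)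
    (ip_integrable (derivEnd i ψ) χ) (ip_integrable ψ (derivEnd i χ)) (ip_integrable ψ χ)
    (fun x _ => ψ.2.1.differentiable (by simp) x) (fun x _ => χ.2.1.differentiable (by simp) x)
  have key' : ip ψ (derivEnd i χ) = -ip (derivEnd i ψ) χ := key
  rw [key', neg_neg]

/-- The canonical momentum `p_i = -iħ ∂_i`. -/
def pOp (ħ : ℝ) (i : Fin 3) : Op :=
  ⟨(-(Complex.I * ħ)) • derivEnd i, (-(Complex.I * ħ)) • derivEnd i, fun ψ χ => by
    rw [LinearMap.smul_apply, LinearMap.smul_apply, ip_smul_left, ip_smul_right, ip_deriv]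
    simp⟩

/-- Multiplication by a smooth real function of position, on wave functions. -/
def mulEnd (f : Space → ℝ) (hf : ContDiff ℝ ∞ f) : Module.End ℂ WaveFn where
  toFun ψ := ⟨fun x => (f x : ℂ) • ψ.1 x,
    (Complex.ofRealCLM.contDiff.comp hf).smul ψ.2.1,
    ψ.2.2.smul_left (f := fun x => (f x : ℂ))⟩
  map_add' ψ χ := by
    apply Subtype.ext
    funext x
    exact smul_add (f x : ℂ) (ψ.1 x) (χ.1 x)
  map_smul' z ψ := by
    apply Subtype.ext
    funext x
    exact smul_comm (f x : ℂ) z (ψ.1 x)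

/-- Multiplication by a smooth real function of position. -/
def mulOp (f : Space → ℝ) (hf : ContDiff ℝ ∞ f) : Op :=
  ⟨mulEnd f hf, mulEnd f hf, fun ψ χ => by
    unfold ip
    congr 1
    funext x
    change inner ℂ ((f x : ℂ) • ψ.1 x) (χ.1 x) = inner ℂ (ψ.1 x) ((f x : ℂ) • χ.1 x)
    rw [inner_smul_left, inner_smul_right, Complex.conj_ofReal]⟩

/-- The action of a complex `2 × 2` matrix on the spinor index. -/
def spinEnd (M : Matrix (Fin 2) (Fin 2) ℂ) : Module.End ℂ WaveFn where
  toFun ψ := ⟨fun x => Matrix.toEuclideanLin M (ψ.1 x),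
    (((Matrix.toEuclideanLin M).restrictScalars ℝ).toContinuousLinearMap.contDiff).comp ψ.2.1,
    ψ.2.2.comp_left (g := fun v => Matrix.toEuclideanLin M v) (map_zero _)⟩
  map_add' ψ χ := by
    apply Subtype.ext
    funext x
    exact map_add (Matrix.toEuclideanLin M) (ψ.1 x) (χ.1 x)
  map_smul' z ψ := by
    apply Subtype.ext
    funext x
    exact map_smul (Matrix.toEuclideanLin M) z (ψ.1 x)

/-- A complex `2 × 2` matrix as a spin operator. -/
def spinOp (M : Matrix (Fin 2) (Fin 2) ℂ) : Op :=
  ⟨spinEnd M, spinEnd M.conjTranspose, fun ψ χ => by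
    unfold ip
    congr 1
    funext x
    change inner ℂ (Matrix.toEuclideanLin M (ψ.1 x)) (χ.1 x)
      = inner ℂ (ψ.1 x) (Matrix.toEuclideanLin M.conjTranspose (χ.1 x))
    rw [Matrix.toEuclideanLin_conjTranspose_eq_adjoint, LinearMap.adjoint_inner_right]⟩

/-- The Pauli matrices. -/
def pauli : Fin 3 → Matrix (Fin 2) (Fin 2) ℂ :=
  ![!![0, 1; 1, 0], !![0, -Complex.I; Complex.I, 0], !![1, 0; 0, -1]]

/-! ## Expansions to first order in the field strength and in powers of `1/c` -/

/-- Operators `T₀ + ε T₁` with `ε² = 0`: operators to linear order in the field strength, which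
is scaled as `ε F_{μν}`. -/
abbrev FOp := DualNumber Op

/-- Formal Laurent series in `1/c` with coefficients in `FOp`; the monomial of degree `n : ℤ` is
`(1/c)^n`. -/
abbrev Ser := LaurentSeries FOp

instance : Ring FOp := inferInstance
instance : Algebra ℂ FOp := inferInstance
instance : Ring Ser := inferInstance
instance : Algebra ℂ Ser := inferInstance

/-- A complex number as a (constant) series. -/
def scal (z : ℂ) : Ser := algebraMap ℂ Ser z

/-- The operator `T₀ + ε T₁` as a series without further dependence on `c`. -/
def lift (T₀ T₁ : Op) : Ser := HahnSeries.C (TrivSqZeroExt.inl T₀ + TrivSqZeroExt.inr T₁)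

/-- The speed of light. -/
def c : Ser := HahnSeries.single (-1) 1

/-- The inverse speed of light. -/
def cinv : Ser := HahnSeries.single 1 1

theorem c_mul_cinv : c * cinv = 1 := by
  simp [c, cinv]

/-- The formal adjoint `(T₀ + ε T₁)† = T₀† + ε T₁†`. -/
def dagF : FOp →+ FOp where
  toFun T := TrivSqZeroExt.inl (star T.fst) + TrivSqZeroExt.inr (star T.snd)
  map_zero' := by simp
  map_add' S T := by
    ext <;> simp

/-- The formal adjoint of a series, coefficient by coefficient (`c` and `ε` being real). -/
def dag (x : Ser) : Ser := x.map dagF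

/-- `y` is the positive square root of `x`: `y² = x`, and the leading coefficient of `y` is a
positive real number. -/
def IsPosSqrt (y x : Ser) : Prop :=
  y * y = x ∧ ∃ (r : ℝ) (n : ℤ), 0 < r ∧ y.coeff n = algebraMap ℂ FOp r ∧
    ∀ k < n, y.coeff k = 0

theorem coeff_mul_lowest {x y : Ser} {a b : ℤ} (hx : ∀ k < a, x.coeff k = 0)
    (hy : ∀ k < b, y.coeff k = 0) : (x * y).coeff (a + b) = x.coeff a * y.coeff b := by
  rw [HahnSeries.coeff_mul]
  by_cases h : x.coeff a ≠ 0 ∧ y.coeff b ≠ 0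
  · apply Finset.sum_eq_single_of_mem (a, b)
    · simp [h.1, h.2]
    · rintro ⟨i, j⟩ hij hne
      simp only [Finset.mem_antidiagonal, HahnSeries.mem_support] at hij
      exfalso
      rcases lt_trichotomy i a with hi | hi | hi
      · exact hij.1 (hx i hi)
      · exact hne (Prod.ext hi (by have := hij.2.2; omega))
      · exact hij.2.1 (hy j (by omega))
  · have h0 : x.coeff a * y.coeff b = 0 := by
      by_cases hxa : x.coeff a = 0
      · rw [hxa, zero_mul]
      · have hyb : y.coeff b = 0 := by
          by_contra hyb
          exact h ⟨hxa, hyb⟩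
        rw [hyb, mul_zero]
    rw [h0]
    apply Finset.sum_eq_zero
    rintro ⟨i, j⟩ hij
    simp only [Finset.mem_antidiagonal, HahnSeries.mem_support] at hij
    exfalso
    rcases lt_trichotomy i a with hi | hi | hi
    · exact hij.1 (hx i hi)
    · subst hi
      have hj : j = b := by omega
      subst hj
      exact h ⟨hij.1, hij.2.1⟩
    · exact hij.2.1 (hy j (by omega))

/-- The positive square root is unique. -/
theorem IsPosSqrt.unique {x y z : Ser} (hy : IsPosSqrt y x) (hz : IsPosSqrt z x) : y = z := by
  obtain ⟨hy2, r, a, hr, hya, hy0⟩ := hy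
  obtain ⟨hz2, s, b, hs, hzb, hz0⟩ := hz
  by_contra hne
  set d : Ser := y - z with hd
  have hd0 : d ≠ 0 := sub_ne_zero.mpr hne
  have hsum : d * y + z * d = 0 := by
    rw [hd, sub_mul, mul_sub, hy2, hz2]
    abel
  have hdn : ∀ k < d.order, d.coeff k = 0 := fun k hk => HahnSeries.coeff_eq_zero_of_lt_order hk
  have hdl : d.coeff d.order ≠ 0 := HahnSeries.coeff_order_eq_zero.not.mpr hd0
  have cancel : ∀ t : ℝ, 0 < t → algebraMap ℂ FOp t * d.coeff d.order ≠ 0 := by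
    intro t ht h
    apply hdl
    rw [← Algebra.smul_def] at h
    exact (smul_eq_zero_iff_right (by exact_mod_cast ht.ne')).mp h
  have below : ∀ {u v : Ser} {i j k : ℤ}, (∀ l < i, u.coeff l = 0) → (∀ l < j, v.coeff l = 0) →
      k < i + j → (u * v).coeff k = 0 := by
    intro u v i j k hu hv hk
    have := coeff_mul_lowest (x := u) (y := v) (a := i) (b := k - i) hu
      (fun l hl => hv l (by omega))
    rw [show i + (k - i) = k by ring, hv (k - i) (by omega), mul_zero] at this
    exact this
  rcases lt_trichotomy a b with hab | hab | hab
  · have h1 := congrArg (fun w : Ser => w.coeff (d.order + a)) hsum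
    simp only [HahnSeries.coeff_add, HahnSeries.coeff_zero] at h1
    rw [coeff_mul_lowest hdn hy0, below hz0 hdn (by omega), add_zero, hya,
      ← Algebra.commutes] at h1
    exact cancel r hr h1
  · subst hab
    have h1 := congrArg (fun w : Ser => w.coeff (d.order + a)) hsum
    simp only [HahnSeries.coeff_add, HahnSeries.coeff_zero] at h1
    rw [coeff_mul_lowest hdn hy0, add_comm d.order a, coeff_mul_lowest hz0 hdn, hya, hzb,
      ← Algebra.commutes, ← add_mul, ← map_add] at h1
    exact cancel (r + s) (by linarith) (by exact_mod_cast h1)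
  · have h1 := congrArg (fun w : Ser => w.coeff (b + d.order)) hsum
    simp only [HahnSeries.coeff_add, HahnSeries.coeff_zero] at h1
    rw [coeff_mul_lowest hz0 hdn, below hdn hy0 (by omega), zero_add, hzb] at h1
    exact cancel s hs h1

open Classical in
/-- The positive square root of a series. -/
def sqrt (x : Ser) : Ser := if h : ∃ y, IsPosSqrt y x then h.choose else 0

/-! ## The potentials -/

/-- Smooth time-independent potentials `φ = φ₀ + ε φ₁` and `A = A₀ + ε A₁`. -/
structure Potentials where
  φ₀ : Space → ℝ
  φ₁ : Space → ℝ
  A₀ : Fin 3 → Space → ℝ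
  A₁ : Fin 3 → Space → ℝ
  smooth_φ₀ : ContDiff ℝ ∞ φ₀
  smooth_φ₁ : ContDiff ℝ ∞ φ₁
  smooth_A₀ : ∀ i, ContDiff ℝ ∞ (A₀ i)
  smooth_A₁ : ∀ i, ContDiff ℝ ∞ (A₁ i)

/-- The electric field `-∇φ` of a static scalar potential. -/
def negGrad (φ : Space → ℝ) (x : Space) : Fin 3 → ℝ := fun i => -pd i φ x

/-- The magnetic field `∇ × A`. -/
def curl (A : Fin 3 → Space → ℝ) (x : Space) : Fin 3 → ℝ :=
  ![pd 1 (A 2) x - pd 2 (A 1) x, pd 2 (A 0) x - pd 0 (A 2) x, pd 0 (A 1) x - pd 1 (A 0) x]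

/-- The field strength of the potentials is homogeneous and of first order in `ε`: the electric
field is `ε E` and the magnetic field is `ε B`. (At order `ε⁰` the potentials are pure gauge.) -/
def Potentials.HasFields (P : Potentials) (E B : Fin 3 → ℝ) : Prop :=
  ∀ x, negGrad P.φ₀ x = 0 ∧ negGrad P.φ₁ x = E ∧ curl P.A₀ x = 0 ∧ curl P.A₁ x = B

/-- The scalar potential as an operator. -/
def Potentials.φ (P : Potentials) : Ser :=
  lift (mulOp P.φ₀ P.smooth_φ₀) (mulOp P.φ₁ P.smooth_φ₁)

/-- The vector potential as an operator. -/
def Potentials.A (P : Potentials) (i : Fin 3) : Ser :=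
  lift (mulOp (P.A₀ i) (P.smooth_A₀ i)) (mulOp (P.A₁ i) (P.smooth_A₁ i))

/-- A homogeneous field `ε F`. -/
def field (F : Fin 3 → ℝ) (i : Fin 3) : Ser := lift 0 (algebraMap ℂ Op (F i))

/-- The kinematic momentum `π = p - (q/c) A`. -/
def kinMom (ħ q : ℝ) (P : Potentials) (i : Fin 3) : Ser :=
  lift (pOp ħ i) 0 - scal q * cinv * P.A i

/-- The Pauli matrices as series. -/
def σ (i : Fin 3) : Ser := lift (spinOp (pauli i)) 0

/-! ## The Dirac and Dirac-Pauli Hamiltonians -/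

/-- `4 × 4` matrices of operators, as `2 × 2` matrices of operators on two-component spinors. -/
abbrev Mat := Matrix (Fin 2) (Fin 2) Ser

/-- The Dirac matrix `β`. -/
def β : Mat := !![1, 0; 0, -1]

/-- The Dirac matrices `α`. -/
def α (i : Fin 3) : Mat := !![0, σ i; σ i, 0]

/-- The spin matrices `Σ`. -/
def spinMat (i : Fin 3) : Mat := !![σ i, 0; 0, σ i]

/-- The Dirac Hamiltonian `m c² β + c α·(p - (q/c) A) + q φ`. -/
def diracH (ħ m q : ℝ) (P : Potentials) : Mat :=
  (scal m * c ^ 2) • β + c • ∑ i, kinMom ħ q P i • α i + (scal q * P.φ) • 1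

/-- The Dirac-Pauli Hamiltonian `diracH + μ' (-β Σ·B + i β α·E)`. -/
def diracPauliH (ħ m q : ℝ) (μ' : Ser) (P : Potentials) (E B : Fin 3 → ℝ) : Mat :=
  diracH ħ m q P +
    μ' • (-(∑ i, field B i • (β * spinMat i)) + scal Complex.I • ∑ i, field E i • (β * α i))

/-! ## The Foldy-Wouthuysen transformation -/

/-- The adjoint of a matrix of operators. -/
def matDag (M : Mat) : Mat := Matrix.of fun i j => dag (M j i)

/-- `Y = 1 / √(1 + X†X)`. -/
def fwY (X : Ser) : Ser := Ring.inverse (sqrt (1 + dag X * X))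

/-- `Z = 1 / √(1 + XX†)`. -/
def fwZ (X : Ser) : Ser := Ring.inverse (sqrt (1 + X * dag X))

/-- The matrix `U` built from `X`. -/
def fwU (X : Ser) : Mat := !![fwY X, fwY X * dag X; -(fwZ X * X), fwZ X]

/-- The transformed Hamiltonian `U H U†`. -/
def fwTransform (X : Ser) (H : Mat) : Mat := fwU X * H * matDag (fwU X)

/-- `X = ∑_{j ≥ 1} X_j / c^j` and `U H U†` is block-diagonal. -/
def IsFW (H : Mat) (X : Ser) : Prop :=
  (∀ n ≤ 0, X.coeff n = 0) ∧ fwTransform X H 0 1 = 0 ∧ fwTransform X H 1 0 = 0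

/-- The antihermitian part of an operator. -/
def antiherm (x : Ser) : Ser := scal (1 / 2) * (x - dag x)

/-! ## The classical Hamiltonian

The expressions below make sense over every ring `K` with a square root function; over `K = ℝ`
with `Real.sqrt` they are the classical Hamiltonians as functions on phase space, with `π` the
value of `p - (q/c) A` and `φ`, `E`, `B` evaluated at the position. -/

section Classical

variable {K : Type*} [Ring K]

/-- The scalar product of two vectors. -/
def dot (a b : Fin 3 → K) : K := ∑ i, a i * b i

/-- The vector product of two vectors. -/
def cross (a b : Fin 3 → K) : Fin 3 → K :=
  ![a 1 * b 2 - a 2 * b 1, a 2 * b 0 - a 0 * b 2, a 0 * b 1 - a 1 * b 0]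

/-- `π / (m c)`. -/
def redMom (m c : K) (π : Fin 3 → K) (i : Fin 3) : K := Ring.inverse (m * c) * π i

/-- The Lorentz factor `γ_π = √(1 + (π/(mc))²)`. -/
def lorentz (root : K → K) (m c : K) (π : Fin 3 → K) : K :=
  root (1 + dot (redMom m c π) (redMom m c π))

/-- `√(m²c⁴ + c²π²) + q φ`. -/
def orbitH (root : K → K) (m c q φ : K) (π : Fin 3 → K) : K :=
  root (m ^ 2 * c ^ 4 + c ^ 2 * dot π π) + q * φ

/-- The Thomas-Bargmann-Michel-Telegdi spin Hamiltonian with anomalous gyromagnetic ratio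
`γm`, namely `-s·[(γm + (q/mc)(1/γ)) B - γm (1/(γ(1+γ))) (π/(mc)·B) π/(mc)`
`- (γm (1/γ) + (q/mc)(1/(γ(1+γ)))) (π/(mc) × E)]` with `γ = γ_π`. -/
def spinH (root : K → K) (m c q γm : K) (s π E B : Fin 3 → K) : K :=
  let γ := lorentz root m c π
  let u := redMom m c π;
  -dot s fun i =>
    (γm + q * Ring.inverse (m * c) * Ring.inverse γ) * B i
      - γm * Ring.inverse (γ * (1 + γ)) * dot u B * u i
      - (γm * Ring.inverse γ + q * Ring.inverse (m * c) * Ring.inverse (γ * (1 + γ))) *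
          cross u E i

/-- The total classical Hamiltonian, to linear order in the field strength. -/
def classicalH (root : K → K) (m c q φ γm : K) (s π E B : Fin 3 → K) : K :=
  orbitH root m c q φ π + spinH root m c q γm s π E B

end Classical

end

end DiracPauli

open DiracPauli

/-! Measured in units of the central element mc², both Hamiltonians are one matrix with rows (1 + V
- b, u + a) and (u - a, -1 + V + b) (`pertH`), where u = σ·π/(mc), V = qφ/(mc²), a = iμ'σ·E/(mc²)
and b = μ'σ·B/(mc²); the Dirac case is a = b = 0. Apart from a central constant in V, the elements
V, a, b are multiples of ε, so products of two field terms vanish. Closed forms exist because u²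
commutes with a, b and [V, u]: the fields are constant, and u² is (π/mc)², which does not touch the
spin, plus a multiple of ε.

Block-diagonality is equivalent to a Riccati equation for X (`isFW_iff`). Apart from its 2X, every
term containing X carries an extra positive power of 1/c, so there is at most one solution
(`eq_of_riccati`). With E = √(1 + u²) the solution without fields is X₀ = u/(1 + E), and the
first-order correction τ satisfies Eτ + τE = S with an explicit S. A series with positive leading
coefficient commutes with everything its square commutes with (`PosLead.commute_of_commute_sq`);
hence E commutes with S, and τ = S/(2E) (`gen_riccati`).

The upper left block is then W(H₀₀ + H₀₁X)W⁻¹ with W = √(1 + X†X). Of the terms in the middle only V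
fails to commute with W, at the cost of -[V, E]/(2E(1 + E)) (`conj_eq_of_sq`). Together with the
contributions of τ, a and b this is a closed form in [u, [V, u]], [a, u] and bu + ub
(`blockCorr_eq`). The Pauli identity and the commutators of π and φ turn these into σ·(π × E) and
π·B, while the magnetic term in u² separates E from γ (`fwTransform_eq`). The antihermitian parts
vanish because both Hamiltonians, and so their transforms, are selfadjoint. -/

namespace DiracPauli

noncomputable section

/-! ## Central elements -/

theorem scal_eq (z : ℂ) : scal z = HahnSeries.single 0 (algebraMap ℂ FOp z) :=
  HahnSeries.algebraMap_apply

theorem scal_comm (z : ℂ) (x : Ser) : Commute (scal z) x := Algebra.commutes z x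

theorem single_one_comm (a : ℤ) (x : Ser) : Commute (HahnSeries.single a (1 : FOp)) x := by
  ext n : 2
  rw [HahnSeries.coeff_single_mul, HahnSeries.coeff_mul_single, one_mul, mul_one]

theorem cinv_comm (x : Ser) : Commute cinv x := single_one_comm _ x

theorem cinv_mul_c : cinv * c = 1 := by rw [(cinv_comm c).eq, c_mul_cinv]

theorem scal_mul (z w : ℂ) : scal z * scal w = scal (z * w) := (map_mul (algebraMap ℂ Ser) z w).symm

theorem scal_one : scal 1 = 1 := map_one (algebraMap ℂ Ser)

theorem scal_neg (z : ℂ) : scal (-z) = -scal z := map_neg (algebraMap ℂ Ser) z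

theorem scal_two : scal 2 = 2 := map_ofNat (algebraMap ℂ Ser) 2

theorem isUnit_scal {z : ℂ} (hz : z ≠ 0) : IsUnit (scal z) :=
  (IsUnit.mk0 z hz).map (algebraMap ℂ Ser)

theorem isUnit_two : IsUnit (2 : Ser) := by
  rw [← scal_two]
  exact isUnit_scal two_ne_zero

/-! ## Orders of vanishing -/

/-- The series `x` has no terms of degree below `a` in `1/c`. -/
def OrdGE (a : ℤ) (x : Ser) : Prop := ∀ k < a, x.coeff k = 0

theorem OrdGE.mono {a b : ℤ} {x : Ser} (h : OrdGE b x) (hab : a ≤ b) : OrdGE a x :=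
  fun k hk => h k (by omega)

theorem OrdGE.add {a : ℤ} {x y : Ser} (hx : OrdGE a x) (hy : OrdGE a y) : OrdGE a (x + y) :=
  fun k hk => by rw [HahnSeries.coeff_add, hx k hk, hy k hk, add_zero]

theorem OrdGE.neg {a : ℤ} {x : Ser} (hx : OrdGE a x) : OrdGE a (-x) :=
  fun k hk => by rw [HahnSeries.coeff_neg, hx k hk, neg_zero]

theorem OrdGE.sub {a : ℤ} {x y : Ser} (hx : OrdGE a x) (hy : OrdGE a y) : OrdGE a (x - y) := by
  rw [sub_eq_add_neg]
  exact hx.add hy.neg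

theorem OrdGE.mul {a b : ℤ} {x y : Ser} (hx : OrdGE a x) (hy : OrdGE b y) :
    OrdGE (a + b) (x * y) := by
  intro k hk
  have := coeff_mul_lowest (x := x) (y := y) (a := a) (b := k - a) hx
    (fun l hl => hy l (by omega))
  rwa [show a + (k - a) = k by ring, hy (k - a) (by omega), mul_zero] at this

theorem OrdGE.mul_of_le {a b n : ℤ} {x y : Ser} (hx : OrdGE a x) (hy : OrdGE b y)
    (h : n ≤ a + b) : OrdGE n (x * y) := (hx.mul hy).mono h

theorem ordGE_single (a : ℤ) (r : FOp) : OrdGE a (HahnSeries.single a r) :=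
  fun _ hk => HahnSeries.coeff_single_of_ne hk.ne

theorem ordGE_cinv : OrdGE 1 cinv := ordGE_single 1 1

theorem ordGE_c : OrdGE (-1) c := ordGE_single (-1) 1

theorem ordGE_scal (z : ℂ) : OrdGE 0 (scal z) := by
  rw [scal_eq]
  exact ordGE_single 0 _

theorem ordGE_lift (S T : Op) : OrdGE 0 (lift S T) := ordGE_single 0 _

theorem ordGE_one : OrdGE 0 1 := ordGE_single 0 1

theorem ordGE_sum {ι : Type*} {a : ℤ} (s : Finset ι) {f : ι → Ser} (h : ∀ i ∈ s, OrdGE a (f i)) :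
    OrdGE a (∑ i ∈ s, f i) := by
  classical
  induction s using Finset.induction_on with
  | empty => exact fun k _ => by simp
  | insert i s hi ih =>
    rw [Finset.sum_insert hi]
    exact (h i (Finset.mem_insert_self i s)).add
      (ih fun j hj => h j (Finset.mem_insert_of_mem hj))

/-- A lower bound on the order that can always be raised by one passes every degree. Uniqueness of
the generator rests on this. -/
theorem eq_zero_of_forall_ordGE {x : Ser} {a : ℤ} (h0 : OrdGE a x)
    (h : ∀ n, OrdGE n x → OrdGE (n + 1) x) : x = 0 := by
  have key : ∀ n : ℕ, OrdGE (a + n) x := by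
    intro n
    induction n with
    | zero => simpa using h0
    | succ n ih =>
      have := h _ ih
      push_cast
      rwa [← add_assoc]
  ext k : 2
  exact key (k - a + 1).toNat k (by omega)

/-! ## Series with positive leading coefficient -/

/-- The leading coefficient of `y` is a positive real number. -/
def PosLead (y : Ser) : Prop :=
  ∃ (r : ℝ) (n : ℤ), 0 < r ∧ y.coeff n = algebraMap ℂ FOp r ∧ ∀ k < n, y.coeff k = 0

/-- If `d` were nonzero, the lowest coefficient of the anticommutator would be twice a positive real
times the lowest coefficient of `d`. -/
theorem PosLead.eq_zero_of_anticommute {y d : Ser} (hy : PosLead y) (h : d * y + y * d = 0) :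
    d = 0 := by
  obtain ⟨r, a, hr, hya, hy0⟩ := hy
  by_contra hd0
  have hdn : ∀ k < d.order, d.coeff k = 0 := fun k hk => HahnSeries.coeff_eq_zero_of_lt_order hk
  have hdl : d.coeff d.order ≠ 0 := HahnSeries.coeff_order_eq_zero.not.mpr hd0
  have h1 := congrArg (fun w : Ser => w.coeff (d.order + a)) h
  simp only [HahnSeries.coeff_add, HahnSeries.coeff_zero] at h1
  rw [coeff_mul_lowest hdn hy0, add_comm d.order a, coeff_mul_lowest hy0 hdn, hya,
    ← Algebra.commutes, ← add_mul, ← map_add, ← Algebra.smul_def] at h1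
  refine hdl ((smul_eq_zero_iff_right ?_).mp h1)
  exact_mod_cast (show r + r ≠ 0 by linarith)

/-- For d = [x, y] one has dy + yd = [x, y²] = 0, so d = 0. This carries commutation with 1 + u²
over to its square root. -/
theorem PosLead.commute_of_commute_sq {y x : Ser} (hy : PosLead y) (h : Commute (y * y) x) :
    Commute y x := by
  have : x * y - y * x = 0 := hy.eq_zero_of_anticommute (by
    have := h.eq
    calc _ = x * (y * y) - y * y * x := by noncomm_ring
      _ = 0 := by rw [this, sub_self])
  exact (sub_eq_zero.mp this).symm

theorem IsPosSqrt.posLead {y x : Ser} (h : IsPosSqrt y x) : PosLead y := h.2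

theorem IsPosSqrt.commute {y x z : Ser} (h : IsPosSqrt y x) (hz : Commute x z) : Commute y z :=
  h.posLead.commute_of_commute_sq (by rwa [h.1])

theorem IsPosSqrt.sqrt_eq {y x : Ser} (h : IsPosSqrt y x) : sqrt x = y := by
  have hex : ∃ y, IsPosSqrt y x := ⟨y, h⟩
  unfold sqrt
  rw [dif_pos hex]
  exact hex.choose_spec.unique h

theorem IsPosSqrt.isPosSqrt_sqrt {y x : Ser} (h : IsPosSqrt y x) : IsPosSqrt (sqrt x) x := by
  rwa [h.sqrt_eq]

theorem exists_eq_ofPowerSeries {x : Ser} (h : OrdGE 0 x) :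
    ∃ f : PowerSeries FOp, x = HahnSeries.ofPowerSeries ℤ FOp f ∧
      ∀ n : ℕ, PowerSeries.coeff n f = x.coeff n := by
  refine ⟨PowerSeries.mk fun n => x.coeff n, ?_, fun n => PowerSeries.coeff_mk _ _⟩
  ext k : 2
  rcases lt_or_ge k 0 with hk | hk
  · rw [h k hk, HahnSeries.ofPowerSeries_apply, HahnSeries.embDomain_of_notMem_range]
    rintro ⟨n, hn⟩
    have : (n : ℤ) = k := hn
    omega
  · lift k to ℕ using hk
    rw [HahnSeries.ofPowerSeries_apply_coeff, PowerSeries.coeff_mk]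

/-- Once the leading power of 1/c is split off, a power series remains whose constant coefficient is
a nonzero real; it is invertible on both sides although `FOp` is noncommutative. -/
theorem PosLead.isUnit {y : Ser} (hy : PosLead y) : IsUnit y := by
  obtain ⟨r, n, hr, hn, h0⟩ := hy
  have hs : HahnSeries.single n (1 : FOp) * HahnSeries.single (-n) 1 = 1 := by simp
  have hs' : HahnSeries.single (-n) (1 : FOp) * HahnSeries.single n 1 = 1 := by simp
  have hy : y = HahnSeries.single n (1 : FOp) * (HahnSeries.single (-n) (1 : FOp) * y) := by
    rw [← mul_assoc, hs, one_mul]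
  obtain ⟨f, hf, hfc⟩ := exists_eq_ofPowerSeries (x := HahnSeries.single (-n) (1 : FOp) * y)
    (fun k hk => by
      rw [HahnSeries.coeff_single_mul, h0 _ (by omega), mul_zero])
  rw [hy]
  refine IsUnit.mul ⟨⟨_, _, hs, hs'⟩, rfl⟩ ?_
  rw [hf]
  have hr' : (r : ℂ) ≠ 0 := by exact_mod_cast hr.ne'
  let v : FOpˣ := Units.map (algebraMap ℂ FOp).toMonoidHom (Units.mk0 (r : ℂ) hr')
  have hv : PowerSeries.constantCoeff f = v := by
    rw [← PowerSeries.coeff_zero_eq_constantCoeff_apply, hfc, HahnSeries.coeff_single_mul]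
    simp [hn, v]
  exact IsUnit.map _ ⟨⟨f, f.invOfUnit v, f.mul_invOfUnit v hv, f.invOfUnit_mul v hv⟩, rfl⟩

theorem posLead_one_add {t : Ser} (ht : OrdGE 1 t) : PosLead (1 + t) := by
  refine ⟨1, 0, one_pos, ?_, fun k hk => ?_⟩
  · rw [HahnSeries.coeff_add, ht 0 (by omega)]
    simp
  · rw [HahnSeries.coeff_add, ht k (by omega), ordGE_one k hk, add_zero]

/-- A self-map of power series whose `n`-th output coefficient depends only on the input
coefficients below `n` has a fixed point. -/
theorem exists_fixedPoint {R : Type*} [Semiring R] (F : PowerSeries R → PowerSeries R)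
    (hF : ∀ n (f g : PowerSeries R), (∀ k < n, PowerSeries.coeff k f = PowerSeries.coeff k g) →
      PowerSeries.coeff n (F f) = PowerSeries.coeff n (F g)) :
    ∃ f, F f = f := by
  -- The k-th coefficient of the iterates of 0 is stationary from iterate k + 1 on, which explains
  -- the n + 1 in the limit below.
  have key : ∀ n k, k < n → ∀ m, n ≤ m →
      PowerSeries.coeff k (F^[m] 0) = PowerSeries.coeff k (F^[n] 0) := by
    intro n
    induction n with
    | zero => intro k hk; omega
    | succ n ih =>
      intro k hk m hm
      obtain ⟨m, rfl⟩ : ∃ m', m = m' + 1 := ⟨m - 1, by omega⟩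
      rw [Function.iterate_succ_apply', Function.iterate_succ_apply']
      exact hF k _ _ fun j hj => ih j (by omega) m (by omega)
  refine ⟨PowerSeries.mk fun n => PowerSeries.coeff n (F^[n + 1] 0), ?_⟩
  ext n
  rw [PowerSeries.coeff_mk, Function.iterate_succ_apply']
  refine hF n _ _ fun k hk => ?_
  rw [PowerSeries.coeff_mk]
  exact (key (k + 1) k (by omega) n hk).symm

/-- Write the root as 1 + G/c. Then 2G = ct - G²/c, and the factor 1/c shifts the quadratic term by
one degree, so the coefficients of G are determined recursively. -/
theorem exists_isPosSqrt_one_add {t : Ser} (ht : OrdGE 1 t) :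
    ∃ s, OrdGE 1 s ∧ IsPosSqrt (1 + s) (1 + t) := by
  obtain ⟨f, hf, -⟩ := exists_eq_ofPowerSeries (x := c * t) (ordGE_c.mul ht)
  obtain ⟨g, hg⟩ := exists_fixedPoint
    (fun g : PowerSeries FOp => (1 / 2 : ℂ) • (f - PowerSeries.X * (g * g))) (by
      intro n g g' h
      simp only [map_sub, PowerSeries.coeff_smul]
      congr 2
      cases n with
      | zero => simp
      | succ n =>
        rw [PowerSeries.coeff_succ_X_mul, PowerSeries.coeff_succ_X_mul, PowerSeries.coeff_mul,
          PowerSeries.coeff_mul]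
        refine Finset.sum_congr rfl fun ij hij => ?_
        have := Finset.HasAntidiagonal.mem_antidiagonal.mp hij
        rw [h _ (by omega), h _ (by omega)])
  have hg2 : (2 : PowerSeries FOp) * g = f - PowerSeries.X * (g * g) := by
    have : (2 : ℂ) • g = f - PowerSeries.X * (g * g) := by
      nth_rewrite 1 [← hg]
      rw [smul_smul]
      norm_num
    rwa [Algebra.smul_def, map_ofNat] at this
  have hG := congrArg (HahnSeries.ofPowerSeries ℤ FOp) hg2
  simp only [map_mul, map_sub, map_ofNat, HahnSeries.ofPowerSeries_X, ← hf] at hG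
  set G : Ser := HahnSeries.ofPowerSeries ℤ FOp g with hGdef
  have hG0 : OrdGE 0 G := by
    intro k hk
    rw [hGdef, HahnSeries.ofPowerSeries_apply, HahnSeries.embDomain_of_notMem_range]
    rintro ⟨n, hn⟩
    have : (n : ℤ) = k := hn
    omega
  have hs : OrdGE 1 (cinv * G) := ordGE_cinv.mul hG0
  refine ⟨cinv * G, hs, ?_, posLead_one_add hs⟩
  change 2 * G = c * t - cinv * (G * G) at hG
  have e1 : cinv * G * (cinv * G) = cinv * (cinv * (G * G)) := by
    rw [mul_assoc, ← mul_assoc G cinv G, ← (cinv_comm G).eq, mul_assoc]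
  have e2 : cinv * (2 * G) = t - cinv * (cinv * (G * G)) := by
    rw [hG, mul_sub, ← mul_assoc, cinv_mul_c, one_mul]
  have e3 : cinv * (2 * G) = cinv * G + cinv * G := by noncomm_ring
  calc (1 + cinv * G) * (1 + cinv * G) = 1 + (cinv * G + cinv * G) + cinv * G * (cinv * G) := by
        noncomm_ring
    _ = 1 + t := by rw [← e3, e2, e1]; abel

theorem isPosSqrt_sqrt_one_add {t : Ser} (ht : OrdGE 1 t) : IsPosSqrt (sqrt (1 + t)) (1 + t) := by
  obtain ⟨s, -, hs⟩ := exists_isPosSqrt_one_add ht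
  exact hs.isPosSqrt_sqrt

theorem ordGE_sqrt_one_add_sub_one {t : Ser} (ht : OrdGE 1 t) : OrdGE 1 (sqrt (1 + t) - 1) := by
  obtain ⟨s, hs, h⟩ := exists_isPosSqrt_one_add ht
  rwa [h.sqrt_eq, add_sub_cancel_left]

theorem IsPosSqrt.isUnit {y x : Ser} (h : IsPosSqrt y x) : IsUnit y := h.posLead.isUnit

/-! ## Adjoints -/

theorem dagF_mul (S T : FOp) : dagF (S * T) = dagF T * dagF S := by
  ext <;> simp [dagF, add_comm]

theorem dagF_dagF (S : FOp) : dagF (dagF S) = S := by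
  ext <;> simp [dagF]

theorem coeff_dag (x : Ser) (n : ℤ) : (dag x).coeff n = dagF (x.coeff n) := rfl

theorem dag_dag (x : Ser) : dag (dag x) = x := by
  ext n : 2
  rw [coeff_dag, coeff_dag, dagF_dagF]

theorem dag_add (x y : Ser) : dag (x + y) = dag x + dag y := by
  ext n : 2
  simp [coeff_dag]

theorem dag_zero : dag 0 = 0 := by
  ext n : 2
  simp [coeff_dag]

theorem dag_neg (x : Ser) : dag (-x) = -dag x := by
  ext n : 2
  simp [coeff_dag]

theorem dag_sub (x y : Ser) : dag (x - y) = dag x - dag y := by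
  ext n : 2
  simp [coeff_dag]

theorem support_dag (x : Ser) : (dag x).support = x.support := by
  ext n
  simp only [HahnSeries.mem_support, coeff_dag, ne_eq, not_iff_not]
  constructor
  · intro h
    rw [← dagF_dagF (x.coeff n), h, map_zero]
  · intro h
    rw [h, map_zero]

/-- The adjoint reverses the factors in each coefficient and degrees add commutatively, so swapping
the index pairs matches the two sums. -/
theorem dag_mul (x y : Ser) : dag (x * y) = dag y * dag x := by
  ext n : 2
  rw [coeff_dag, HahnSeries.coeff_mul, HahnSeries.coeff_mul, map_sum]
  refine Finset.sum_nbij' Prod.swap Prod.swap ?_ ?_ (fun _ _ => rfl) (fun _ _ => rfl) ?_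
  · rintro ⟨i, j⟩ h
    simp only [Finset.mem_antidiagonal, support_dag, Prod.swap] at h ⊢
    exact ⟨h.2.1, h.1, by rw [add_comm, h.2.2]⟩
  · rintro ⟨i, j⟩ h
    simp only [Finset.mem_antidiagonal, support_dag, Prod.swap] at h ⊢
    exact ⟨h.2.1, h.1, by rw [add_comm, h.2.2]⟩
  · rintro ⟨i, j⟩ -
    exact dagF_mul _ _

theorem dag_one : dag 1 = 1 := by
  ext n : 2
  rw [coeff_dag, HahnSeries.coeff_one]
  split_ifs
  · ext <;> simp [dagF]
  · exact map_zero _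

theorem dag_single (n : ℤ) (T : FOp) :
    dag (HahnSeries.single n T) = HahnSeries.single n (dagF T) := by
  ext k : 2
  rw [coeff_dag]
  rcases eq_or_ne k n with rfl | h
  · simp
  · simp [HahnSeries.coeff_single_of_ne h]

theorem star_algebraMap (z : ℂ) :
    star (algebraMap ℂ Op z) = algebraMap ℂ Op ((starRingEnd ℂ) z) := by
  refine star_eq_of_isAdj fun ψ χ => ?_
  change ip (z • ψ) χ = ip ψ ((starRingEnd ℂ) z • χ)
  rw [ip_smul_left, ip_smul_right]

theorem dag_lift (S T : Op) : dag (lift S T) = lift (star S) (star T) := by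
  change dag (HahnSeries.single 0 _) = HahnSeries.single 0 _
  rw [dag_single]
  congr 1
  ext <;> simp [dagF]

theorem scal_eq_lift (z : ℂ) : scal z = lift (algebraMap ℂ Op z) 0 := by
  rw [scal_eq]
  change _ = HahnSeries.single 0 _
  congr 1
  ext <;> simp [TrivSqZeroExt.algebraMap_eq_inl']

theorem OrdGE.dag {a : ℤ} {x : Ser} (hx : OrdGE a x) : OrdGE a (dag x) :=
  fun k hk => by rw [coeff_dag, hx k hk, map_zero]

theorem dagF_algebraMap (z : ℂ) :
    dagF (algebraMap ℂ FOp z) = algebraMap ℂ FOp ((starRingEnd ℂ) z) := by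
  ext <;> simp [dagF, TrivSqZeroExt.algebraMap_eq_inl', star_algebraMap]

theorem IsPosSqrt.dag {x y : Ser} (h : IsPosSqrt y x) : IsPosSqrt (dag y) (dag x) := by
  obtain ⟨h2, r, n, hr, hn, h0⟩ := h
  refine ⟨by rw [← dag_mul, h2], r, n, hr, ?_, fun k hk => ?_⟩
  · rw [coeff_dag, hn, dagF_algebraMap, Complex.conj_ofReal]
  · rw [coeff_dag, h0 k hk, map_zero]

/-- The adjoint of a positive root is a positive root of the adjoint, and positive roots are unique.
-/
theorem IsPosSqrt.dag_eq {x y : Ser} (h : IsPosSqrt y x) (hx : DiracPauli.dag x = x) :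
    DiracPauli.dag y = y := by
  have := h.dag
  rw [hx] at this
  exact this.unique h

theorem inverse_eq {x y : Ser} (h : x * y = 1) (h' : y * x = 1) : Ring.inverse x = y :=
  Ring.inverse_unit (⟨x, y, h, h'⟩ : Serˣ)

theorem dag_inverse {x : Ser} (h : IsUnit x) : dag (Ring.inverse x) = Ring.inverse (dag x) := by
  refine (inverse_eq ?_ ?_).symm
  · rw [← dag_mul, Ring.inverse_mul_cancel x h, dag_one]
  · rw [← dag_mul, Ring.mul_inverse_cancel x h, dag_one]

theorem commute_inverse {x y : Ser} (hx : IsUnit x) (h : Commute x y) :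
    Commute (Ring.inverse x) y := by
  obtain ⟨u, rfl⟩ := hx
  rw [Ring.inverse_unit]
  exact h.units_inv_left

/-! ## The Foldy-Wouthuysen transformation -/

theorem ordGE_dag_mul_self {X : Ser} (hX : OrdGE 1 X) : OrdGE 1 (dag X * X) :=
  hX.dag.mul_of_le hX (by norm_num)

theorem ordGE_mul_dag_self {X : Ser} (hX : OrdGE 1 X) : OrdGE 1 (X * dag X) :=
  hX.mul_of_le hX.dag (by norm_num)

/-- The inverse square root of a selfadjoint series `1 + t`, with `t` of positive order. -/
theorem inverse_sqrt_spec {t : Ser} (ht : OrdGE 1 t) (hd : dag t = t) :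
    let Y := Ring.inverse (sqrt (1 + t))
    dag Y = Y ∧ IsUnit Y ∧ Y * Y * (1 + t) = 1 ∧ (1 + t) * (Y * Y) = 1 ∧ Y * (1 + t) * Y = 1 := by
  intro Y
  have h := isPosSqrt_sqrt_one_add ht
  have hu := h.isUnit
  have h1 : Y * sqrt (1 + t) = 1 := Ring.inverse_mul_cancel _ hu
  have h2 : sqrt (1 + t) * Y = 1 := Ring.mul_inverse_cancel _ hu
  refine ⟨?_, ⟨⟨Y, _, h1, h2⟩, rfl⟩, ?_, ?_, ?_⟩
  · rw [dag_inverse hu, h.dag_eq (by rw [dag_add, dag_one, hd])]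
  · rw [← h.1, mul_assoc, ← mul_assoc Y (sqrt _), h1, one_mul, h1]
  · rw [← h.1, mul_assoc, ← mul_assoc _ Y, h2, one_mul, h2]
  · calc _ = Y * (sqrt (1 + t) * sqrt (1 + t)) * Y := by rw [h.1]
      _ = 1 := by rw [← mul_assoc, h1, one_mul, h2]

theorem fwY_spec {X : Ser} (hX : OrdGE 1 X) :
    dag (fwY X) = fwY X ∧ IsUnit (fwY X) ∧ fwY X * fwY X * (1 + dag X * X) = 1 ∧
      (1 + dag X * X) * (fwY X * fwY X) = 1 ∧ fwY X * (1 + dag X * X) * fwY X = 1 :=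
  inverse_sqrt_spec (ordGE_dag_mul_self hX) (by rw [dag_mul, dag_dag])

theorem fwZ_spec {X : Ser} (hX : OrdGE 1 X) :
    dag (fwZ X) = fwZ X ∧ IsUnit (fwZ X) ∧ fwZ X * fwZ X * (1 + X * dag X) = 1 ∧
      (1 + X * dag X) * (fwZ X * fwZ X) = 1 ∧ fwZ X * (1 + X * dag X) * fwZ X = 1 :=
  inverse_sqrt_spec (ordGE_mul_dag_self hX) (by rw [dag_mul, dag_dag])

theorem matDag_fwU {X : Ser} (hX : OrdGE 1 X) :
    matDag (fwU X) = !![fwY X, -(dag X * fwZ X); X * fwY X, fwZ X] := by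
  ext i j : 2
  fin_cases i <;> fin_cases j <;>
    simp [matDag, fwU, dag_mul, dag_neg, dag_dag, (fwY_spec hX).1, (fwZ_spec hX).1]

theorem fwU_mul_matDag {X : Ser} (hX : OrdGE 1 X) : fwU X * matDag (fwU X) = 1 := by
  obtain ⟨-, -, -, -, hY⟩ := fwY_spec hX
  obtain ⟨-, -, -, -, hZ⟩ := fwZ_spec hX
  rw [matDag_fwU hX, fwU, Matrix.mul_fin_two, Matrix.one_fin_two]
  congr 4
  · rw [← hY]; noncomm_ring
  · noncomm_ring
  · noncomm_ring
  · congr 1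
    rw [← hZ]; noncomm_ring

/-- This side needs the intertwining relation (1 + XX†)X = X(1 + X†X), which for the inverses Y² and
Z² reads Z²X = XY². -/
theorem matDag_mul_fwU {X : Ser} (hX : OrdGE 1 X) : matDag (fwU X) * fwU X = 1 := by
  obtain ⟨-, -, hY1, hY2, -⟩ := fwY_spec hX
  obtain ⟨-, -, hZ1, hZ2, -⟩ := fwZ_spec hX
  have hX1 : fwZ X * fwZ X * X = X * (fwY X * fwY X) :=
    calc _ = fwZ X * fwZ X * (X * ((1 + dag X * X) * (fwY X * fwY X))) := by rw [hY2, mul_one]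
      _ = fwZ X * fwZ X * (1 + X * dag X) * (X * (fwY X * fwY X)) := by noncomm_ring
      _ = _ := by rw [hZ1, one_mul]
  have hX2 : dag X * (fwZ X * fwZ X) = fwY X * fwY X * dag X :=
    calc _ = fwY X * fwY X * (1 + dag X * X) * (dag X * (fwZ X * fwZ X)) := by
          rw [hY1, one_mul]
      _ = fwY X * fwY X * (dag X * ((1 + X * dag X) * (fwZ X * fwZ X))) := by noncomm_ring
      _ = _ := by rw [hZ2, mul_one]
  rw [matDag_fwU hX, fwU, Matrix.mul_fin_two, Matrix.one_fin_two]
  congr 4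
  · calc _ = fwY X * fwY X + dag X * (fwZ X * fwZ X * X) := by noncomm_ring
      _ = (1 + dag X * X) * (fwY X * fwY X) := by rw [hX1]; noncomm_ring
      _ = 1 := hY2
  · calc _ = fwY X * fwY X * dag X - dag X * (fwZ X * fwZ X) := by noncomm_ring
      _ = 0 := by rw [hX2, sub_self]
  · calc _ = X * (fwY X * fwY X) - fwZ X * fwZ X * X := by noncomm_ring
      _ = 0 := by rw [hX1, sub_self]
  · congr 1
    calc _ = X * (fwY X * fwY X * dag X) + fwZ X * fwZ X := by noncomm_ring
      _ = (1 + X * dag X) * (fwZ X * fwZ X) := by rw [← hX2]; noncomm_ring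
      _ = 1 := hZ2

theorem matDag_matDag (M : Mat) : matDag (matDag M) = M :=
  Matrix.ext fun _ _ => dag_dag _

theorem matDag_mul (M N : Mat) : matDag (M * N) = matDag N * matDag M := by
  ext i j : 2
  simp [matDag, Matrix.mul_apply, dag_add, dag_mul]

theorem matDag_fwTransform (X : Ser) {H : Mat} (hH : matDag H = H) :
    matDag (fwTransform X H) = fwTransform X H := by
  rw [fwTransform, matDag_mul, matDag_mul, matDag_matDag, hH, mul_assoc]

theorem antiherm_eq_zero {x : Ser} (h : dag x = x) : antiherm x = 0 := by
  rw [antiherm, h, sub_self, mul_zero]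

/-- The equation satisfied by `X` when `U_X H U_X†` is block-diagonal. -/
def riccati (H : Mat) (X : Ser) : Ser :=
  H 1 0 + H 1 1 * X - X * H 0 0 - X * H 0 1 * X

/-- Up to the outer factors, this entry pairs the row (-X, 1) with H applied to the column (1, X).
-/
theorem fwTransform_one_zero {X : Ser} (hX : OrdGE 1 X) (H : Mat) :
    fwTransform X H 1 0 = fwZ X * riccati H X * fwY X := by
  rw [fwTransform, matDag_fwU hX, fwU, riccati]
  simp only [Matrix.mul_apply, Fin.sum_univ_two, Matrix.of_apply, Matrix.cons_val', Matrix.cons_val_zero,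
    Matrix.cons_val_one, Matrix.cons_val_fin_one]
  noncomm_ring

/-- Y and Z are units, so they can be cancelled in the lower left entry; the upper right entry is
its adjoint because `H` is selfadjoint. -/
theorem isFW_iff {X : Ser} {H : Mat} (hH : matDag H = H) :
    IsFW H X ↔ OrdGE 1 X ∧ riccati H X = 0 := by
  have hpos : (∀ n ≤ 0, X.coeff n = 0) ↔ OrdGE 1 X :=
    ⟨fun h k hk => h k (by omega), fun h k hk => h k (by omega)⟩
  rw [IsFW, hpos]
  refine and_congr_right fun hX => ⟨fun h => ?_, fun h => ?_⟩
  · have h10 := h.2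
    rw [fwTransform_one_zero hX, (fwY_spec hX).2.1.mul_left_eq_zero,
      (fwZ_spec hX).2.1.mul_right_eq_zero] at h10
    exact h10
  · have h10 : fwTransform X H 1 0 = 0 := by
      rw [fwTransform_one_zero hX, h, mul_zero, zero_mul]
    refine ⟨?_, h10⟩
    have := congrFun (congrFun (matDag_fwTransform X hH) 0) 1
    rw [← this]
    change dag (fwTransform X H 1 0) = 0
    rw [h10, dag_zero]

/-- The Riccati equation says that H sends the column (1, X) to (1, X) times H₀₀ + H₀₁X. Pairing
with (1, X†) gives the factor 1 + X†X = W², and with Y = W⁻¹ on both sides a similarity by W is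
left. -/
theorem fwTransform_zero_zero {X : Ser} (hX : OrdGE 1 X) {H : Mat} (h : riccati H X = 0) :
    fwTransform X H 0 0 =
      sqrt (1 + dag X * X) * (H 0 0 + H 0 1 * X) * Ring.inverse (sqrt (1 + dag X * X)) := by
  have hs := isPosSqrt_sqrt_one_add (ordGE_dag_mul_self hX)
  have h1 : fwY X * sqrt (1 + dag X * X) = 1 := Ring.inverse_mul_cancel _ hs.isUnit
  have e : H 1 0 + H 1 1 * X = X * (H 0 0 + H 0 1 * X) := by
    rw [← sub_eq_zero, ← h, riccati]
    noncomm_ring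
  have : fwTransform X H 0 0 =
      fwY X * (H 0 0 + H 0 1 * X + dag X * (H 1 0 + H 1 1 * X)) * fwY X := by
    rw [fwTransform, matDag_fwU hX, fwU]
    simp only [Matrix.mul_apply, Fin.sum_univ_two, Matrix.of_apply, Matrix.cons_val',
      Matrix.cons_val_zero, Matrix.cons_val_one, Matrix.cons_val_fin_one]
    noncomm_ring
  rw [this, e]
  calc _ = fwY X * (1 + dag X * X) * (H 0 0 + H 0 1 * X) * fwY X := by noncomm_ring
    _ = fwY X * (sqrt (1 + dag X * X) * sqrt (1 + dag X * X)) * (H 0 0 + H 0 1 * X) * fwY X := by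
      rw [hs.1]
    _ = _ := by
      rw [← mul_assoc (fwY X), h1, one_mul]
      rfl

/-! ## First-order series -/

theorem lift_mul (S T S' T' : Op) : lift S T * lift S' T' = lift (S * S') (S * T' + T * S') := by
  rw [lift, lift, lift, ← map_mul]
  congr 1
  ext <;> simp

theorem lift_add (S T S' T' : Op) : lift S T + lift S' T' = lift (S + S') (T + T') := by
  rw [lift, lift, lift, ← map_add]
  congr 1
  ext <;> simp

theorem lift_neg (S T : Op) : -lift S T = lift (-S) (-T) := by
  rw [lift, lift, ← map_neg]
  congr 1
  ext <;> simp

theorem lift_sub (S T S' T' : Op) : lift S T - lift S' T' = lift (S - S') (T - T') := by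
  rw [sub_eq_add_neg, lift_neg, lift_add, sub_eq_add_neg, sub_eq_add_neg]

/-- The expansion parameter `ε`. -/
def eps : Ser := lift 0 1

theorem eps_comm (x : Ser) : Commute eps x := by
  ext n : 2
  rw [eps, lift, HahnSeries.C_apply, HahnSeries.coeff_single_mul, HahnSeries.coeff_mul_single]
  ext <;> simp

theorem eps_mul_eps : eps * eps = 0 := by
  rw [eps, lift_mul]
  simp [lift]

/-- `z` is a multiple of `ε`. -/
def IsFirst (z : Ser) : Prop := ∃ w, z = eps * w

theorem IsFirst.add {x y : Ser} : IsFirst x → IsFirst y → IsFirst (x + y) := by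
  rintro ⟨a, rfl⟩ ⟨b, rfl⟩
  exact ⟨a + b, (mul_add _ _ _).symm⟩

theorem IsFirst.neg {x : Ser} : IsFirst x → IsFirst (-x) := by
  rintro ⟨a, rfl⟩
  exact ⟨-a, (mul_neg _ _).symm⟩

theorem IsFirst.sub {x y : Ser} (hx : IsFirst x) (hy : IsFirst y) : IsFirst (x - y) := by
  rw [sub_eq_add_neg]
  exact hx.add hy.neg

theorem IsFirst.mul_right {x : Ser} (y : Ser) : IsFirst x → IsFirst (x * y) := by
  rintro ⟨a, rfl⟩
  exact ⟨a * y, mul_assoc _ _ _⟩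

theorem IsFirst.mul_left {x : Ser} (y : Ser) : IsFirst x → IsFirst (y * x) := by
  rintro ⟨a, rfl⟩
  exact ⟨y * a, by rw [← mul_assoc, ← (eps_comm y).eq, mul_assoc]⟩

/-- This is the truncation to linear order in the fields: ε is central with square zero. -/
theorem IsFirst.mul_eq_zero {x y : Ser} : IsFirst x → IsFirst y → x * y = 0 := by
  rintro ⟨a, rfl⟩ ⟨b, rfl⟩
  calc eps * a * (eps * b) = eps * (a * eps) * b := by noncomm_ring
    _ = eps * eps * a * b := by rw [← (eps_comm a).eq]; noncomm_ring
    _ = 0 := by rw [eps_mul_eps, zero_mul, zero_mul]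

theorem IsFirst.commute {x y : Ser} (hx : IsFirst x) (hy : IsFirst y) : Commute x y := by
  rw [Commute, SemiconjBy, hx.mul_eq_zero hy, hy.mul_eq_zero hx]

theorem dag_eps : dag eps = eps := by
  rw [eps, dag_lift, star_zero, star_one]

theorem IsFirst.dag {x : Ser} : IsFirst x → IsFirst (dag x) := by
  rintro ⟨a, rfl⟩
  rw [dag_mul, dag_eps]
  exact IsFirst.mul_left _ ⟨1, (mul_one _).symm⟩

/-! ## Inverses of series of order zero -/

/-- If `y` began in a negative degree, the coefficient of `x * y` there would be `r` times the
leading coefficient of `y`, whereas 1 has none. -/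
theorem ordGE_inverse {x y : Ser} {r : ℝ} (hr : 0 < r) (hx : OrdGE 1 (x - scal r))
    (h : x * y = 1) : OrdGE 0 y := by
  have hc : x.coeff 0 = algebraMap ℂ FOp r := by
    have := hx 0 (by omega)
    rw [HahnSeries.coeff_sub, scal_eq, HahnSeries.coeff_single_same, sub_eq_zero] at this
    exact this
  have h0 : OrdGE 0 x := by
    have := (hx.mono (by norm_num : (0 : ℤ) ≤ 1)).add (ordGE_scal r)
    rwa [sub_add_cancel] at this
  intro k hk
  by_cases hy : y = 0
  · rw [hy, HahnSeries.coeff_zero]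
  rcases lt_or_ge k y.order with hlt | hge
  · exact HahnSeries.coeff_eq_zero_of_lt_order hlt
  exfalso
  have hl := coeff_mul_lowest (x := x) (y := y) (a := 0) (b := y.order) h0
    (fun l hl => HahnSeries.coeff_eq_zero_of_lt_order hl)
  rw [h, zero_add, ordGE_one _ (by omega), hc, ← Algebra.smul_def] at hl
  exact HahnSeries.coeff_order_eq_zero.not.mpr hy
    ((smul_eq_zero_iff_right (by exact_mod_cast hr.ne')).mp hl.symm)

theorem posLead_of_sub {x : Ser} {r : ℝ} (hr : 0 < r) (hx : OrdGE 1 (x - scal r)) : PosLead x := by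
  have e : x = (x - scal r) + scal r := by abel
  refine ⟨r, 0, hr, ?_, fun k hk => ?_⟩
  · rw [e, HahnSeries.coeff_add, hx 0 (by omega), scal_eq, HahnSeries.coeff_single_same, zero_add]
  · rw [e, HahnSeries.coeff_add, hx k (by omega), ordGE_scal _ k hk, add_zero]

/-! ## The block-diagonalisation of a perturbed free Hamiltonian -/

/-- The operators entering a Hamiltonian with blocks `1 + V - b`, `u + a`, `u - a`, `-1 + V + b`:
`V`, `a` and `b` are of first order up to a central summand of `V`, and `u²` commutes with `a`,
`b` and `[V, u]`. -/
structure IsPerturbation (u V a b : Ser) : Prop where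
  ord_u : OrdGE 1 u
  ord_V : OrdGE 1 V
  ord_a : OrdGE 1 a
  ord_b : OrdGE 1 b
  dag_u : dag u = u
  central_V : ∃ v₀ v₁, V = v₀ + v₁ ∧ (∀ x, Commute v₀ x) ∧ IsFirst v₁
  first_a : IsFirst a
  first_b : IsFirst b
  comm_a : Commute (u * u) a
  comm_b : Commute (u * u) b
  comm_V : Commute (u * u) (V * u - u * V)

/-- The energy `√(1 + u²)`. -/
def energy (u : Ser) : Ser := sqrt (1 + u * u)

/-- The generator for the unperturbed Hamiltonian. -/
def freeGen (u : Ser) : Ser := u * Ring.inverse (1 + energy u)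

/-- The inhomogeneity of the linearised equation for the generator. -/
def source (u V a b : Ser) : Ser :=
  V * freeGen u - freeGen u * V - a - freeGen u * a * freeGen u + b * freeGen u + freeGen u * b

/-- The generator for the perturbed Hamiltonian. -/
def gen (u V a b : Ser) : Ser := freeGen u + Ring.inverse (2 * energy u) * source u V a b

/-! ### Energy and free generator: orders, inverses, commutation -/

namespace IsPerturbation

variable {u V a b : Ser} (D : IsPerturbation u V a b)
include D

theorem ord_uu : OrdGE 1 (u * u) := D.ord_u.mul_of_le D.ord_u (by norm_num)

theorem isPosSqrt : IsPosSqrt (energy u) (1 + u * u) := isPosSqrt_sqrt_one_add D.ord_uu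

theorem energy_sq : energy u * energy u = 1 + u * u := D.isPosSqrt.1

theorem isUnit_energy : IsUnit (energy u) := D.isPosSqrt.isUnit

theorem energy_comm {z : Ser} (h : Commute (u * u) z) : Commute (energy u) z :=
  D.isPosSqrt.commute ((Commute.one_left z).add_left h)

theorem energy_comm_u : Commute (energy u) u := D.energy_comm ((Commute.refl u).mul_left (.refl u))

theorem dag_energy : dag (energy u) = energy u :=
  D.isPosSqrt.dag_eq (by rw [dag_add, dag_one, dag_mul, D.dag_u])

theorem ord_energy : OrdGE 1 (energy u - 1) := ordGE_sqrt_one_add_sub_one D.ord_uu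

theorem ord_one_add_energy : OrdGE 1 (1 + energy u - scal (2 : ℝ)) := by
  have : (1 + energy u - scal (2 : ℝ) : Ser) = energy u - 1 := by
    rw [show ((2 : ℝ) : ℂ) = 2 by norm_num, scal_two,
      ← one_add_one_eq_two]
    noncomm_ring
  rw [this]
  exact D.ord_energy

theorem ord_two_mul_energy : OrdGE 1 (2 * energy u - scal (2 : ℝ)) := by
  have : (2 * energy u - scal (2 : ℝ) : Ser) = (energy u - 1) + (energy u - 1) := by
    rw [show ((2 : ℝ) : ℂ) = 2 by norm_num, scal_two,
      ← one_add_one_eq_two]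
    noncomm_ring
  rw [this]
  exact D.ord_energy.add D.ord_energy

theorem isUnit_one_add_energy : IsUnit (1 + energy u) :=
  (posLead_of_sub two_pos D.ord_one_add_energy).isUnit

theorem isUnit_two_mul_energy : IsUnit (2 * energy u) :=
  (posLead_of_sub two_pos D.ord_two_mul_energy).isUnit

theorem ord_inv_one_add : OrdGE 0 (Ring.inverse (1 + energy u)) :=
  ordGE_inverse two_pos D.ord_one_add_energy (Ring.mul_inverse_cancel _ D.isUnit_one_add_energy)

theorem ord_inv_two_mul : OrdGE 0 (Ring.inverse (2 * energy u)) :=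
  ordGE_inverse two_pos D.ord_two_mul_energy (Ring.mul_inverse_cancel _ D.isUnit_two_mul_energy)

theorem inv_one_add_comm {z : Ser} (h : Commute (energy u) z) :
    Commute (Ring.inverse (1 + energy u)) z :=
  commute_inverse D.isUnit_one_add_energy ((Commute.one_left z).add_left h)

theorem inv_two_mul_comm {z : Ser} (h : Commute (energy u) z) :
    Commute (Ring.inverse (2 * energy u)) z :=
  commute_inverse D.isUnit_two_mul_energy ((Commute.ofNat_left 2 z).mul_left h)

theorem ord_freeGen : OrdGE 1 (freeGen u) := D.ord_u.mul D.ord_inv_one_add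

theorem ord_source : OrdGE 1 (source u V a b) := by
  have h := D.ord_freeGen
  exact (((((D.ord_V.mul_of_le h (by norm_num)).sub (h.mul_of_le D.ord_V (by norm_num))).sub
    D.ord_a).sub ((h.mul D.ord_a).mul_of_le h (by norm_num))).add
    (D.ord_b.mul_of_le h (by norm_num))).add (h.mul_of_le D.ord_b (by norm_num))

theorem ord_gen : OrdGE 1 (gen u V a b) :=
  D.ord_freeGen.add (D.ord_inv_two_mul.mul D.ord_source)

/-- The part of V that is not first order is central and drops out of commutators. -/
theorem first_commutator (x : Ser) : IsFirst (V * x - x * V) := by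
  obtain ⟨v₀, v₁, rfl, h₀, h₁⟩ := D.central_V
  have : (v₀ + v₁) * x - x * (v₀ + v₁) = v₁ * x - x * v₁ := by
    rw [add_mul, mul_add, (h₀ x).eq]
    abel
  rw [this]
  exact (h₁.mul_right x).sub (h₁.mul_left x)

theorem comm_first {x : Ser} (hx : IsFirst x) : Commute V x := by
  obtain ⟨v₀, v₁, rfl, h₀, h₁⟩ := D.central_V
  exact (h₀ x).add_left (h₁.commute hx)

/-- Let e = [V, u] and f = [V, E]. Commuting V with E² = 1 + u² gives fE + Ef = eu + ue, which
commutes with E because e and u do. Hence E² commutes with f, and so does E. -/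
theorem commute_energy_commutator_energy :
    Commute (energy u) (V * energy u - energy u * V) := by
  refine D.isPosSqrt.posLead.commute_of_commute_sq ?_
  have hs := D.energy_sq
  have hE := D.energy_comm_u
  have h : Commute (energy u) ((V * energy u - energy u * V) * energy u +
      energy u * (V * energy u - energy u * V)) := by
    have : (V * energy u - energy u * V) * energy u + energy u * (V * energy u - energy u * V) =
        (V * u - u * V) * u + u * (V * u - u * V) :=
      calc _ = V * (energy u * energy u) - energy u * energy u * V := by noncomm_ring
        _ = _ := by rw [hs]; noncomm_ring
    rw [this]
    have he := D.energy_comm D.comm_V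
    exact (he.mul_right hE).add_right (hE.mul_right he)
  have := h.eq
  have key : energy u * energy u * (V * energy u - energy u * V) -
      (V * energy u - energy u * V) * (energy u * energy u) = 0 :=
    calc _ = energy u * ((V * energy u - energy u * V) * energy u +
        energy u * (V * energy u - energy u * V)) - ((V * energy u - energy u * V) * energy u +
        energy u * (V * energy u - energy u * V)) * energy u := by noncomm_ring
      _ = 0 := by rw [this, sub_self]
  exact sub_eq_zero.mp key

end IsPerturbation

/-- The first-order correction to the upper left block, apart from the reordering of `V`. -/
def blockCorr (u V a b : Ser) : Ser :=
  -b + u * (gen u V a b - freeGen u) + a * freeGen u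

/-- The block matrix `[1 + V - b, u + a; u - a, -1 + V + b]`, scaled by `k`. -/
def pertH (k u V a b : Ser) : Mat :=
  !![k * (1 + V - b), k * (u + a); k * (u - a), k * (-1 + V + b)]

theorem riccati_pertH {k : Ser} (hk : ∀ x, Commute k x) (u V a b X : Ser) :
    riccati (pertH k u V a b) X =
      k * (u - 2 * X - X * u * X - a - X * a * X + (V * X - X * V) + b * X + X * b) := by
  have h : ∀ y, X * (k * y) = k * (X * y) := fun y => by
    rw [← mul_assoc, ← (hk X).eq, mul_assoc]
  change k * (u - a) + k * (-1 + V + b) * X - X * (k * (1 + V - b)) - X * (k * (u + a)) * X = _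
  rw [h, h]
  noncomm_ring

/-- Conjugation of `E + V + r` by `W`, where `W` commutes with `E` and `r`, and only to first order
fails to commute with `V`. -/
theorem conj_eq_of_sq {W E G g V r i : Ser} (hW : PosLead W) (hWW : W * W = 2 - 2 * G + i)
    (hi : IsFirst i) (hVi : Commute V i) (hf : IsFirst (V * E - E * V))
    (hWE : Commute W E) (hWr : Commute W r)
    (hGf : Commute G (V * E - E * V)) (hgE : Commute g E)
    (hgf : Commute g (V * E - E * V))
    (hGV : V * G - G * V = -(G * (V * E - E * V) * G))
    (hG : (1 + E) * G = 1) (hg : 2 * E * g = 1) :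
    W * (E + V + r) * Ring.inverse W = E + V + r - G * g * (V * E - E * V) := by
  set f := V * E - E * V
  set d := W * V - V * W with hd
  -- The left side is [W², V], so only the square of W enters and the root need not be expanded.
  have hp : W * d + d * W = -(2 * (G * f * G)) :=
    calc _ = W * W * V - V * (W * W) := by rw [hd]; noncomm_ring
      _ = 2 * (V * G - G * V) + (i * V - V * i) := by rw [hWW]; noncomm_ring
      _ = _ := by rw [hGV, hVi.eq, sub_self, add_zero, mul_neg]
  have hGfG : Commute W (G * f * G) := by
    refine hW.commute_of_commute_sq ?_
    have hfi : IsFirst (G * f * G) := (hf.mul_left G).mul_right G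
    have h : Commute G (G * f * G) := ((Commute.refl G).mul_right hGf).mul_right (.refl G)
    rw [hWW]
    exact ((Commute.ofNat_left 2 _).sub_left ((Commute.ofNat_left 2 _).mul_left h)).add_left
      (hi.commute hfi)
  have hWd : Commute W d := by
    refine hW.commute_of_commute_sq (sub_eq_zero.mp ?_)
    calc _ = W * (W * d + d * W) - (W * d + d * W) * W := by noncomm_ring
      _ = 0 := by
        rw [hp, mul_neg, neg_mul, (((Commute.ofNat_right W 2).mul_right hGfG)).eq, sub_self]
  -- As W commutes with d, the relation above says dW = -GfG. On the other hand W² = 2(1 - G) + i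
  -- with 1 - G = EG, fi = 0 and 2Eg = 1, so GgfW² equals GfG as well.
  have hd1 : d * W * 2 = -(G * g * f) * W * W * 2 := by
    have e1 : d * W * 2 = -(2 * (G * f * G)) := by rw [← hp, hWd.eq]; noncomm_ring
    have e2 : 1 - G = E * G := by rw [← hG]; noncomm_ring
    have e3 : f * i = 0 := hf.mul_eq_zero hi
    rw [e1]
    symm
    calc _ = -(G * g * f * (W * W) * 2) := by noncomm_ring
      _ = -(4 * (G * (g * f) * (1 - G))) - 2 * (G * g * (f * i)) := by rw [hWW]; noncomm_ring
      _ = -(4 * (G * (f * (g * E)) * G)) := by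
        rw [e3, e2, hgf.eq]; noncomm_ring
      _ = -(2 * (G * (f * (2 * E * g)) * G)) := by rw [hgE.eq]; noncomm_ring
      _ = _ := by rw [hg, mul_one]
  have hd2 : d = -(G * g * f) * W := hW.isUnit.mul_right_cancel (isUnit_two.mul_right_cancel hd1)
  have hd3 : W * (E + V + r) = (E + V + r - G * g * f) * W := by
    calc W * (E + V + r) = (W * E) + (W * r) + V * W + d := by rw [hd]; noncomm_ring
      _ = _ := by rw [hWE.eq, hWr.eq, hd2]; noncomm_ring
  rw [hd3, mul_assoc, Ring.mul_inverse_cancel _ hW.isUnit, mul_one]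

/-! ### Solution of the Riccati equation and the upper left block -/

namespace IsPerturbation

variable {u V a b : Ser} (D : IsPerturbation u V a b)
include D

/-- Subtracting the equations expresses 2(X - X') by terms in which X - X' is multiplied by
something of positive order, so any bound on its order improves by one. -/
theorem eq_of_riccati {X X' : Ser} (hX : OrdGE 1 X) (hX' : OrdGE 1 X')
    (h : u - 2 * X - X * u * X - a - X * a * X + (V * X - X * V) + b * X + X * b = 0)
    (h' : u - 2 * X' - X' * u * X' - a - X' * a * X' + (V * X' - X' * V) + b * X' + X' * b = 0) :
    X = X' := by
  rw [← sub_eq_zero]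
  refine eq_zero_of_forall_ordGE (hX.sub hX') fun n hn => ?_
  have e : scal 2 * (X - X') = V * (X - X') - (X - X') * V + b * (X - X') + (X - X') * b
      - (X - X') * (u + a) * X - X' * (u + a) * (X - X') := by
    rw [scal_two, ← sub_eq_zero]
    calc _ = (u - 2 * X' - X' * u * X' - a - X' * a * X' + (V * X' - X' * V) + b * X' + X' * b)
        - (u - 2 * X - X * u * X - a - X * a * X + (V * X - X * V) + b * X + X * b) := by
          noncomm_ring
      _ = 0 := by rw [h, h', sub_zero]
  have hua := D.ord_u.add D.ord_a
  have ho : OrdGE (n + 1) (scal 2 * (X - X')) := by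
    rw [e]
    exact (((((D.ord_V.mul_of_le hn (by omega)).sub (hn.mul_of_le D.ord_V (by omega))).add
      (D.ord_b.mul_of_le hn (by omega))).add (hn.mul_of_le D.ord_b (by omega))).sub
      ((hn.mul hua).mul_of_le hX (by omega))).sub ((hX'.mul hua).mul_of_le hn (by omega))
  have : X - X' = scal (1 / 2) * (scal 2 * (X - X')) := by
    rw [← mul_assoc, scal_mul]
    norm_num [scal_one]
  rw [this]
  exact (ordGE_scal _).mul_of_le ho (by omega)

theorem one_add_mul_inv : (1 + energy u) * Ring.inverse (1 + energy u) = 1 :=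
  Ring.mul_inverse_cancel _ D.isUnit_one_add_energy

/-- Because u² = E² - 1 = (E - 1)(1 + E). -/
theorem u_mul_freeGen : u * freeGen u = energy u - 1 := by
  have h : u * u = (energy u - 1) * (1 + energy u) := by
    calc u * u = 1 + u * u - 1 := by abel
      _ = _ := by rw [← D.energy_sq]; noncomm_ring
  rw [freeGen, ← mul_assoc, h, mul_assoc, D.one_add_mul_inv, mul_one]

theorem energy_comm_freeGen : Commute (energy u) (freeGen u) :=
  D.energy_comm_u.mul_right (D.inv_one_add_comm (Commute.refl _)).symm

theorem inv_one_add_comm_u : Commute (Ring.inverse (1 + energy u)) u :=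
  D.inv_one_add_comm D.energy_comm_u

theorem freeGen_mul_u : freeGen u * u = energy u - 1 := by
  rw [← D.u_mul_freeGen, freeGen, mul_assoc, D.inv_one_add_comm_u.eq]

/-- Since X₀u = E - 1, the equation reduces to (1 + E)X₀ = u. -/
theorem freeGen_eq : u - 2 * freeGen u - freeGen u * u * freeGen u = 0 := by
  have : 2 * freeGen u + freeGen u * u * freeGen u = u := by
    rw [D.freeGen_mul_u]
    calc 2 * freeGen u + (energy u - 1) * freeGen u = freeGen u + energy u * freeGen u := by
          noncomm_ring
      _ = u * (Ring.inverse (1 + energy u) * (1 + energy u)) := by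
          rw [D.energy_comm_freeGen.eq, freeGen]
          noncomm_ring
      _ = u := by rw [Ring.inverse_mul_cancel _ D.isUnit_one_add_energy, mul_one]
  rw [sub_sub, this, sub_self]

theorem commutator_inv_one_add :
    V * Ring.inverse (1 + energy u) - Ring.inverse (1 + energy u) * V =
      -(Ring.inverse (1 + energy u) * (V * energy u - energy u * V) *
        Ring.inverse (1 + energy u)) := by
  have h1 := D.one_add_mul_inv
  have h2 := Ring.inverse_mul_cancel _ D.isUnit_one_add_energy
  set G := Ring.inverse (1 + energy u)
  calc V * G - G * V = G * (1 + energy u) * V * G - G * V * ((1 + energy u) * G) := by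
        rw [h1, h2, mul_one, one_mul]
    _ = _ := by noncomm_ring

theorem commutator_freeGen :
    V * freeGen u - freeGen u * V = (V * u - u * V) * Ring.inverse (1 + energy u) -
      u * (Ring.inverse (1 + energy u) * (V * energy u - energy u * V) *
        Ring.inverse (1 + energy u)) := by
  have := D.commutator_inv_one_add
  rw [freeGen, ← sub_eq_zero]
  calc _ = u * (V * Ring.inverse (1 + energy u) - Ring.inverse (1 + energy u) * V) +
        u * (Ring.inverse (1 + energy u) * (V * energy u - energy u * V) *
        Ring.inverse (1 + energy u)) := by noncomm_ring
    _ = 0 := by rw [this]; noncomm_ring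

theorem first_source : IsFirst (source u V a b) :=
  ((((D.first_commutator _).sub D.first_a).sub
    ((D.first_a.mul_left _).mul_right _)).add (D.first_b.mul_right _)).add (D.first_b.mul_left _)

/-- The term that needs care is [V, X₀]: it is a combination of [V, u], [V, E], u and (1 + E)⁻¹,
each of which commutes with E. -/
theorem energy_comm_source : Commute (energy u) (source u V a b) := by
  have hG : Commute (energy u) (Ring.inverse (1 + energy u)) :=
    (D.inv_one_add_comm (Commute.refl _)).symm
  have hX := D.energy_comm_freeGen
  have ha := D.energy_comm D.comm_a
  have hb := D.energy_comm D.comm_b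
  have hV : Commute (energy u) (V * freeGen u - freeGen u * V) := by
    rw [D.commutator_freeGen]
    exact ((D.energy_comm D.comm_V).mul_right hG).sub_right (D.energy_comm_u.mul_right
      ((hG.mul_right D.commute_energy_commutator_energy).mul_right hG))
  exact (((hV.sub_right ha).sub_right ((hX.mul_right ha).mul_right hX)).add_right
    (hb.mul_right hX)).add_right (hX.mul_right hb)

omit D in
theorem gen_sub : gen u V a b - freeGen u = Ring.inverse (2 * energy u) * source u V a b :=
  add_sub_cancel_left _ _

theorem first_gen_sub : IsFirst (gen u V a b - freeGen u) := by
  rw [gen_sub]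
  exact D.first_source.mul_left _

theorem energy_comm_gen_sub : Commute (energy u) (gen u V a b - freeGen u) := by
  rw [gen_sub]
  exact (D.inv_two_mul_comm (Commute.refl _)).symm.mul_right D.energy_comm_source

theorem two_mul_energy_mul_gen_sub :
    2 * energy u * (gen u V a b - freeGen u) = source u V a b := by
  rw [gen_sub, ← mul_assoc, Ring.mul_inverse_cancel _ D.isUnit_two_mul_energy, one_mul]

/-- Expand around X₀ with correction τ. The zeroth order is the free equation, and products of two
first-order terms vanish. By uX₀ = X₀u = E - 1 the linear terms 2τ + τuX₀ + X₀uτ become τE + Eτ =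
2Eτ, which is the source by the choice of τ. -/
theorem gen_riccati :
    u - 2 * gen u V a b - gen u V a b * u * gen u V a b - a - gen u V a b * a * gen u V a b +
      (V * gen u V a b - gen u V a b * V) + b * gen u V a b + gen u V a b * b = 0 := by
  have hτ := D.first_gen_sub
  have h2 := D.two_mul_energy_mul_gen_sub
  have hE := D.energy_comm_gen_sub.eq
  have hX : gen u V a b = freeGen u + (gen u V a b - freeGen u) := by abel
  generalize gen u V a b - freeGen u = τ at *
  rw [hX]
  generalize gen u V a b = 𝒳 at *
  have z1 : τ * (u * τ) = 0 := hτ.mul_eq_zero (hτ.mul_left u)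
  have z2 : τ * (a * freeGen u) = 0 := hτ.mul_eq_zero (D.first_a.mul_right _)
  have z3 : freeGen u * a * τ = 0 := (D.first_a.mul_left _).mul_eq_zero hτ
  have z4 : τ * (a * τ) = 0 := hτ.mul_eq_zero (D.first_a.mul_right _)
  have z5 : V * τ - τ * V = 0 := sub_eq_zero.mpr (D.comm_first hτ).eq
  have z6 : b * τ = 0 := D.first_b.mul_eq_zero hτ
  have z7 : τ * b = 0 := hτ.mul_eq_zero D.first_b
  have z8 : τ * (u * freeGen u) = τ * (energy u - 1) := by rw [D.u_mul_freeGen]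
  have z9 : freeGen u * u * τ = (energy u - 1) * τ := by rw [D.freeGen_mul_u]
  calc _ = (u - 2 * freeGen u - freeGen u * u * freeGen u) + source u V a b
        - 2 * τ - τ * (u * freeGen u) - freeGen u * u * τ - τ * (u * τ) - τ * (a * freeGen u)
        - freeGen u * a * τ - τ * (a * τ) + (V * τ - τ * V) + b * τ + τ * b := by
        rw [source]; noncomm_ring
    _ = source u V a b - 2 * τ - τ * (energy u - 1) - (energy u - 1) * τ := by
        rw [z1, z2, z3, z4, z5, z6, z7, z8, z9, D.freeGen_eq]; abel
    _ = source u V a b - energy u * τ - τ * energy u := by noncomm_ring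
    _ = source u V a b - 2 * energy u * τ := by rw [← hE]; noncomm_ring
    _ = 0 := by rw [h2, sub_self]

theorem riccati_gen {k : Ser} (hk : ∀ x, Commute k x) :
    riccati (pertH k u V a b) (gen u V a b) = 0 := by
  rw [riccati_pertH hk, D.gen_riccati, mul_zero]

theorem riccati_eq_zero_iff {k : Ser} (hk : ∀ x, Commute k x) (hku : IsUnit k) {X : Ser}
    (hX : OrdGE 1 X) : riccati (pertH k u V a b) X = 0 ↔ X = gen u V a b := by
  constructor
  · intro h
    rw [riccati_pertH hk, hku.mul_right_eq_zero] at h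
    exact D.eq_of_riccati hX D.ord_gen h D.gen_riccati
  · rintro rfl
    exact D.riccati_gen hk

theorem first_blockCorr : IsFirst (blockCorr u V a b) :=
  (D.first_b.neg.add (D.first_gen_sub.mul_left _)).add (D.first_a.mul_right _)

theorem energy_comm_blockCorr : Commute (energy u) (blockCorr u V a b) :=
  ((D.energy_comm D.comm_b).neg_right.add_right
    (D.energy_comm_u.mul_right D.energy_comm_gen_sub)).add_right
    ((D.energy_comm D.comm_a).mul_right D.energy_comm_freeGen)

theorem upper_row : 1 + V - b + (u + a) * gen u V a b = energy u + V + blockCorr u V a b := by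
  have h := D.first_a.mul_eq_zero D.first_gen_sub
  have h1 : a * gen u V a b = a * freeGen u := by rwa [mul_sub, sub_eq_zero] at h
  rw [blockCorr, add_mul, h1, mul_sub, D.u_mul_freeGen]
  abel

theorem dag_freeGen : dag (freeGen u) = freeGen u := by
  rw [freeGen, dag_mul, dag_inverse D.isUnit_one_add_energy, dag_add, dag_one, D.dag_energy,
    D.dag_u, D.inv_one_add_comm_u.eq]

theorem one_add_freeGen_sq :
    1 + freeGen u * freeGen u = 2 - 2 * Ring.inverse (1 + energy u) := by
  have h : freeGen u * freeGen u = (energy u - 1) * Ring.inverse (1 + energy u) := by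
    rw [← D.freeGen_mul_u]
    nth_rewrite 2 [freeGen]
    rw [mul_assoc]
  have h1 := D.one_add_mul_inv
  rw [h]
  calc _ = 1 + (1 + energy u) * Ring.inverse (1 + energy u) - 2 * Ring.inverse (1 + energy u) := by
        noncomm_ring
    _ = _ := by rw [h1, one_add_one_eq_two]

/-- The first-order remainder may stay unspecified: in the conjugation by √(1 + X†X) it commutes
with V and annihilates [V, E]. -/
theorem dag_gen_mul_gen :
    ∃ i, IsFirst i ∧ dag (gen u V a b) * gen u V a b = freeGen u * freeGen u + i := by
  have hτ := D.first_gen_sub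
  have hX : gen u V a b = freeGen u + (gen u V a b - freeGen u) := by abel
  refine ⟨freeGen u * (gen u V a b - freeGen u) + dag (gen u V a b - freeGen u) * gen u V a b,
    (hτ.mul_left _).add (hτ.dag.mul_right _), ?_⟩
  nth_rewrite 1 [hX]
  rw [dag_add, D.dag_freeGen]
  noncomm_ring

theorem energy_comm_dag_gen_mul_gen : Commute (energy u) (dag (gen u V a b) * gen u V a b) := by
  have h : Commute (energy u) (gen u V a b) := by
    have := D.energy_comm_freeGen.add_right D.energy_comm_gen_sub
    rwa [add_sub_cancel] at this
  refine Commute.mul_right ?_ h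
  have := congrArg dag h.eq
  rw [dag_mul, dag_mul, D.dag_energy] at this
  exact this.symm

/-- The block is E + V + `blockCorr` conjugated by W = √(1 + X†X). Both E and `blockCorr` commute
with W; the last term comes from moving W past V. -/
theorem fwTransform_pertH {k : Ser} (hk : ∀ x, Commute k x) :
    fwTransform (gen u V a b) (pertH k u V a b) 0 0 =
      k * (energy u + V + blockCorr u V a b -
        Ring.inverse (1 + energy u) * Ring.inverse (2 * energy u) *
          (V * energy u - energy u * V)) := by
  obtain ⟨i, hi, hA⟩ := D.dag_gen_mul_gen
  have hS := isPosSqrt_sqrt_one_add (ordGE_dag_mul_self (D.ord_gen (u := u) (a := a) (b := b)))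
  have hEA := D.energy_comm_dag_gen_mul_gen
  have hsq : 1 + dag (gen u V a b) * gen u V a b =
      2 - 2 * Ring.inverse (1 + energy u) + i := by
    rw [hA, ← add_assoc, D.one_add_freeGen_sq]
  have hup : (pertH k u V a b) 0 0 + (pertH k u V a b) 0 1 * gen u V a b =
      k * (energy u + V + blockCorr u V a b) := by
    rw [← D.upper_row]
    change k * (1 + V - b) + k * (u + a) * gen u V a b = _
    noncomm_ring
  rw [fwTransform_zero_zero D.ord_gen (D.riccati_gen hk), hup, ← mul_assoc, ← (hk _).eq,
    mul_assoc, mul_assoc, ← mul_assoc (sqrt _)]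
  congr 1
  have hWr : Commute (1 + dag (gen u V a b) * gen u V a b) (blockCorr u V a b) := by
    rw [hsq]
    exact ((Commute.ofNat_left 2 _).sub_left ((Commute.ofNat_left 2 _).mul_left
      (D.inv_one_add_comm D.energy_comm_blockCorr))).add_left (hi.commute D.first_blockCorr)
  exact conj_eq_of_sq hS.posLead (hS.1.trans hsq) hi (D.comm_first hi) (D.first_commutator _)
    (hS.commute ((Commute.one_left _).add_left hEA.symm)) (hS.commute hWr)
    (D.inv_one_add_comm D.commute_energy_commutator_energy)
    (D.inv_two_mul_comm (Commute.refl _))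
    (D.inv_two_mul_comm D.commute_energy_commutator_energy)
    D.commutator_inv_one_add D.one_add_mul_inv
    (Ring.mul_inverse_cancel _ D.isUnit_two_mul_energy)

/-- The spin part of the upper left block, in closed form. -/
theorem blockCorr_eq {s r n : Ser}
    (hs : u * (V * u - u * V) - (V * u - u * V) * u = 4 * s) (hr : a * u - u * a = 2 * r)
    (hn : b * u + u * b = 2 * n) :
    blockCorr u V a b - Ring.inverse (1 + energy u) * Ring.inverse (2 * energy u) *
          (V * energy u - energy u * V) =
      Ring.inverse (energy u * (1 + energy u)) * s + Ring.inverse (energy u) * r +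
        Ring.inverse (energy u * (1 + energy u)) * (u * n) - b := by
  have hE := D.energy_comm_u
  have hEe := D.energy_comm D.comm_V
  have hEa := D.energy_comm D.comm_a
  have hEb := D.energy_comm D.comm_b
  have hEf := D.commute_energy_commutator_energy
  have hEX := D.energy_comm_freeGen
  have hG := D.one_add_mul_inv
  have hGf := D.inv_one_add_comm hEf
  have hEu := D.isUnit_energy.mul D.isUnit_one_add_energy
  have hτ := D.two_mul_energy_mul_gen_sub
  have hg := Ring.mul_inverse_cancel _ D.isUnit_two_mul_energy
  have hi := Ring.mul_inverse_cancel _ D.isUnit_energy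
  have hiG := Ring.mul_inverse_cancel _ hEu
  have hu2 := D.energy_sq
  have huX := D.u_mul_freeGen
  have hV := D.commutator_freeGen
  -- Two evaluations of [V, E²]. Since [V, E] commutes with E, this gives 2E[V, E] in terms of [V,
  -- u].
  have hf : (V * energy u - energy u * V) * energy u + energy u * (V * energy u - energy u * V) =
        (V * u - u * V) * u + u * (V * u - u * V) :=
    calc _ = V * (energy u * energy u) - energy u * energy u * V := by noncomm_ring
      _ = _ := by rw [hu2]; noncomm_ring
  rw [← hEf.eq] at hf
  have hGu := D.inv_one_add_comm_u
  have hΓX : (1 + energy u) * freeGen u = u := by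
    rw [add_mul, one_mul, hEX.eq, freeGen]
    calc _ = u * (Ring.inverse (1 + energy u) * (1 + energy u)) := by noncomm_ring
      _ = u := by rw [Ring.inverse_mul_cancel _ D.isUnit_one_add_energy, mul_one]
  have huu : u * u = (1 + energy u) * (energy u - 1) :=
    calc u * u = 1 + u * u - 1 := by abel
      _ = _ := by rw [← hu2]; noncomm_ring
  have hΓG : ∀ x, (1 + energy u) * (Ring.inverse (1 + energy u) * x) = x := fun x => by
    rw [← mul_assoc, hG, one_mul]
  have hΓ : ∀ {z}, Commute (energy u) z → Commute (1 + energy u) z := fun h =>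
    (Commute.one_left _).add_left h
  -- Multiplying the source by (1 + E)u removes its denominators, by (1 + E)X₀ = u and uX₀ = E - 1.
  have hsrc : (1 + energy u) * (u * source u V a b) =
      u * (V * u - u * V) - (energy u - 1) * (V * energy u - energy u * V)
        - (1 + energy u) * (u * a) - (energy u - 1) * (a * u) + u * (2 * n) := by
    have t1 : (1 + energy u) * (u * (V * freeGen u - freeGen u * V)) =
        u * (V * u - u * V) - (energy u - 1) * (V * energy u - energy u * V) := by
      have hGe := D.inv_one_add_comm hEe
      rw [hV]
      generalize V * u - u * V = e at *
      generalize V * energy u - energy u * V = f at *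
      calc _ = (1 + energy u) * (u * (e * Ring.inverse (1 + energy u))) -
            (1 + energy u) * (u * u * (Ring.inverse (1 + energy u) *
              (f * Ring.inverse (1 + energy u)))) := by noncomm_ring
        _ = (1 + energy u) * (Ring.inverse (1 + energy u) * (u * e)) -
            (energy u - 1) * ((1 + energy u) * ((1 + energy u) * (Ring.inverse (1 + energy u) *
              (Ring.inverse (1 + energy u) * f)))) := by
            rw [← hGe.eq, ← hGf.eq, huu, ← mul_assoc u, ← hGu.eq]
            noncomm_ring
        _ = _ := by rw [hΓG, ← mul_assoc (Ring.inverse _) (Ring.inverse _), mul_assoc, hΓG, hΓG]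
    have t2 : (1 + energy u) * (u * (freeGen u * a * freeGen u)) = (energy u - 1) * (a * u) := by
      calc _ = (1 + energy u) * ((u * freeGen u) * (a * freeGen u)) := by noncomm_ring
        _ = (energy u - 1) * ((1 + energy u) * a * freeGen u) := by rw [huX]; noncomm_ring
        _ = _ := by rw [(hΓ hEa).eq, mul_assoc, hΓX]
    have t3 : (1 + energy u) * (u * (b * freeGen u)) = u * (b * u) := by
      rw [← mul_assoc, (hΓ hE).eq, mul_assoc, ← mul_assoc _ b, (hΓ hEb).eq, mul_assoc, hΓX]
    have t4 : (1 + energy u) * (u * (freeGen u * b)) = u * (u * b) := by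
      rw [← mul_assoc u, huX, ← mul_assoc, ← huu, mul_assoc]
    calc _ = (1 + energy u) * (u * (V * freeGen u - freeGen u * V)) - (1 + energy u) * (u * a)
          - (1 + energy u) * (u * (freeGen u * a * freeGen u))
          + ((1 + energy u) * (u * (b * freeGen u)) + (1 + energy u) * (u * (freeGen u * b))) := by
          rw [source]; noncomm_ring
      _ = _ := by rw [t1, t2, t3, t4, ← mul_add, hn]
  -- The unit 4E(1 + E) clears all inverses and matches the factor 4 in the hypothesis on `s`.
  refine (isUnit_two.mul (isUnit_two.mul hEu)).mul_left_cancel ?_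
  have b1 : energy u * (1 + energy u) * (u * (gen u V a b - freeGen u)) * 2 =
      (1 + energy u) * (u * source u V a b) := by
    rw [← hτ]
    calc _ = (1 + energy u) * (energy u * u) * (gen u V a b - freeGen u) * 2 := by noncomm_ring
      _ = _ := by rw [hE.eq]; noncomm_ring
  have b2 : energy u * (1 + energy u) * (Ring.inverse (1 + energy u) *
      Ring.inverse (2 * energy u) * (V * energy u - energy u * V)) * 2 =
      V * energy u - energy u * V := by
    calc _ = energy u * ((1 + energy u) * (Ring.inverse (1 + energy u) *
          (Ring.inverse (2 * energy u) * (V * energy u - energy u * V)))) * 2 := by noncomm_ring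
      _ = 2 * energy u * Ring.inverse (2 * energy u) * (V * energy u - energy u * V) := by
        rw [hΓG]; noncomm_ring
      _ = _ := by rw [hg, one_mul]
  have b3 : energy u * (1 + energy u) * (a * freeGen u) = energy u * (a * u) := by
    rw [mul_assoc, ← mul_assoc _ a, (hΓ hEa).eq, mul_assoc, hΓX]
  have b4 : energy u * (1 + energy u) * (Ring.inverse (energy u) * r) * 2 =
      (1 + energy u) * (a * u - u * a) := by
    rw [hr]
    calc _ = (1 + energy u) * (energy u * Ring.inverse (energy u)) * r * 2 := by noncomm_ring
      _ = _ := by rw [hi]; noncomm_ring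
  have b5 : ∀ x, energy u * (1 + energy u) * (Ring.inverse (energy u * (1 + energy u)) * x) = x :=
    fun x => by rw [← mul_assoc, hiG, one_mul]
  rw [blockCorr]
  calc _ = -(4 * (energy u * (1 + energy u) * b))
        + 2 * (energy u * (1 + energy u) * (u * (gen u V a b - freeGen u)) * 2)
        + 4 * (energy u * (1 + energy u) * (a * freeGen u))
        - 2 * (energy u * (1 + energy u) * (Ring.inverse (1 + energy u) *
            Ring.inverse (2 * energy u) * (V * energy u - energy u * V)) * 2) := by noncomm_ring
    _ = -(4 * (energy u * (1 + energy u) * b)) + 2 * (u * (V * u - u * V))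
        - (energy u * (V * energy u - energy u * V) + energy u * (V * energy u - energy u * V))
        + 2 * ((1 + energy u) * (a * u - u * a)) + 4 * (u * n) := by
        rw [b1, b2, b3, hsrc]; noncomm_ring
    -- With e = [V, u] and f = [V, E]: 2ue - 2Ef = 2ue - (eu + ue) = [u, e] = 4s.
    _ = -(4 * (energy u * (1 + energy u) * b)) + 4 * s
        + 2 * ((1 + energy u) * (a * u - u * a)) + 4 * (u * n) := by
        rw [hf, ← hs]; noncomm_ring
    _ = -(4 * (energy u * (1 + energy u) * b))
        + 4 * (energy u * (1 + energy u) * (Ring.inverse (energy u * (1 + energy u)) * s))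
        + 2 * (energy u * (1 + energy u) * (Ring.inverse (energy u) * r) * 2)
        + 4 * (energy u * (1 + energy u) * (Ring.inverse (energy u * (1 + energy u)) * (u * n))) := by
        rw [b4, b5, b5]
    _ = _ := by noncomm_ring

end IsPerturbation

/-! ## Monomials -/

/-- The monomial `z (1/c)ⁿ`. -/
def mon (z : ℂ) (n : ℤ) : Ser := HahnSeries.single n (algebraMap ℂ FOp z)

theorem mon_comm (z : ℂ) (n : ℤ) (x : Ser) : Commute (mon z n) x := by
  ext k : 2
  rw [mon, HahnSeries.coeff_single_mul, HahnSeries.coeff_mul_single, Algebra.commutes]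

theorem mon_mul_mon (z w : ℂ) (n k : ℤ) : mon z n * mon w k = mon (z * w) (n + k) := by
  rw [mon, mon, mon, HahnSeries.single_mul_single, (algebraMap ℂ FOp).map_mul]

theorem scal_eq_mon (z : ℂ) : scal z = mon z 0 := scal_eq z

theorem c_eq_mon : c = mon 1 (-1) := by rw [mon, map_one]; rfl

theorem cinv_eq_mon : cinv = mon 1 1 := by rw [mon, map_one]; rfl

theorem one_eq_mon : (1 : Ser) = mon 1 0 := by rw [← scal_eq_mon, scal_one]

theorem isUnit_mon {z : ℂ} (hz : z ≠ 0) (n : ℤ) : IsUnit (mon z n) := by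
  refine ⟨⟨mon z n, mon z⁻¹ (-n), ?_, ?_⟩, rfl⟩ <;> rw [mon_mul_mon, one_eq_mon] <;>
    simp [hz]

theorem inverse_mon {z : ℂ} (hz : z ≠ 0) (n : ℤ) : Ring.inverse (mon z n) = mon z⁻¹ (-n) := by
  refine inverse_eq ?_ ?_ <;> rw [mon_mul_mon, one_eq_mon] <;> simp [hz]

theorem ordGE_mon (z : ℂ) (n : ℤ) : OrdGE n (mon z n) := ordGE_single n _

theorem dag_mon (z : ℂ) (n : ℤ) : dag (mon z n) = mon ((starRingEnd ℂ) z) n := by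
  rw [mon, dag_single, dagF_algebraMap, mon]

theorem mon_neg (z : ℂ) (n : ℤ) : -mon z n = mon (-z) n := by
  rw [mon, mon, map_neg]
  exact (map_neg (HahnSeries.single.addMonoidHom n) _).symm

theorem two_mul_mon (z : ℂ) (n : ℤ) : 2 * mon z n = mon (2 * z) n := by
  rw [← scal_two, scal_eq_mon, mon_mul_mon, zero_add]

theorem mon_pow (z : ℂ) (n : ℤ) (k : ℕ) : mon z n ^ k = mon (z ^ k) (k * n) := by
  induction k with
  | zero => simp [one_eq_mon]
  | succ k ih =>
    rw [pow_succ, ih, mon_mul_mon, pow_succ]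
    congr 1
    push_cast
    ring

/-! ## The basic operators -/

theorem Op.ext' {S T : Op} (h : ∀ ψ : WaveFn, S.1 ψ = T.1 ψ) : S = T :=
  Subtype.ext (LinearMap.ext h)

theorem WaveFn.ext' {ψ χ : WaveFn} (h : ∀ x, ψ.1 x = χ.1 x) : ψ = χ := Subtype.ext (funext h)

theorem star_mulOp (f : Space → ℝ) (hf : ContDiff ℝ ∞ f) : star (mulOp f hf) = mulOp f hf := by
  refine star_eq_of_isAdj fun ψ χ => ?_
  unfold ip
  congr 1
  funext x
  change inner ℂ ((f x : ℂ) • ψ.1 x) (χ.1 x) = inner ℂ (ψ.1 x) ((f x : ℂ) • χ.1 x)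
  rw [inner_smul_left, inner_smul_right, Complex.conj_ofReal]

theorem star_pOp (ħ : ℝ) (i : Fin 3) : star (pOp ħ i) = pOp ħ i := by
  refine star_eq_of_isAdj fun ψ χ => ?_
  change ip ((-(Complex.I * ħ)) • derivEnd i ψ) χ = ip ψ ((-(Complex.I * ħ)) • derivEnd i χ)
  rw [ip_smul_left, ip_smul_right, ip_deriv]
  simp

theorem star_spinOp (M : Matrix (Fin 2) (Fin 2) ℂ) : star (spinOp M) = spinOp M.conjTranspose := by
  refine star_eq_of_isAdj fun ψ χ => ?_
  unfold ip
  congr 1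
  funext x
  change inner ℂ (Matrix.toEuclideanLin M (ψ.1 x)) (χ.1 x)
    = inner ℂ (ψ.1 x) (Matrix.toEuclideanLin M.conjTranspose (χ.1 x))
  rw [Matrix.toEuclideanLin_conjTranspose_eq_adjoint, LinearMap.adjoint_inner_right]

theorem mulOp_mul_comm (f g : Space → ℝ) (hf : ContDiff ℝ ∞ f) (hg : ContDiff ℝ ∞ g) :
    Commute (mulOp f hf) (mulOp g hg) :=
  Op.ext' fun ψ => WaveFn.ext' fun x => smul_comm (f x : ℂ) (g x : ℂ) (ψ.1 x)

theorem mulOp_sub (f g : Space → ℝ) (hf : ContDiff ℝ ∞ f) (hg : ContDiff ℝ ∞ g) :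
    mulOp f hf - mulOp g hg = mulOp (fun x => f x - g x) (hf.sub hg) := by
  refine Op.ext' fun ψ => WaveFn.ext' fun x => ?_
  change (f x : ℂ) • ψ.1 x - (g x : ℂ) • ψ.1 x = ((f x - g x : ℝ) : ℂ) • ψ.1 x
  rw [← sub_smul, Complex.ofReal_sub]

theorem mulOp_eq_algebraMap {f : Space → ℝ} (hf : ContDiff ℝ ∞ f) {r : ℝ} (h : ∀ x, f x = r) :
    mulOp f hf = algebraMap ℂ Op r := by
  refine Op.ext' fun ψ => WaveFn.ext' fun x => ?_
  change (f x : ℂ) • ψ.1 x = (r : ℂ) • ψ.1 x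
  rw [h]

theorem contDiff_pd {f : Space → ℝ} (hf : ContDiff ℝ ∞ f) (i : Fin 3) : ContDiff ℝ ∞ (pd i f) :=
  (hf.fderiv_right (m := ∞) (by simp)).clm_apply contDiff_const

/-- The canonical commutation relation, from the Leibniz rule. -/
theorem pOp_mulOp (ħ : ℝ) (i : Fin 3) {f : Space → ℝ} (hf : ContDiff ℝ ∞ f) :
    pOp ħ i * mulOp f hf - mulOp f hf * pOp ħ i =
      algebraMap ℂ Op (-(Complex.I * ħ)) * mulOp (pd i f) (contDiff_pd hf i) := by
  refine Op.ext' fun ψ => WaveFn.ext' fun x => ?_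
  change (-(Complex.I * ħ)) • fderiv ℝ (fun y => (f y : ℂ) • ψ.1 y) x (EuclideanSpace.single i 1) -
    (f x : ℂ) • ((-(Complex.I * ħ)) • fderiv ℝ ψ.1 x (EuclideanSpace.single i 1)) =
    (-(Complex.I * ħ)) • ((fderiv ℝ f x (EuclideanSpace.single i 1) : ℝ) : ℂ) • ψ.1 x
  have h1 : DifferentiableAt ℝ f x := hf.differentiable (by simp) x
  have h2 : DifferentiableAt ℝ ψ.1 x := ψ.2.1.differentiable (by simp) x
  have e : (fun y => (f y : ℂ) • ψ.1 y) = fun y => f y • ψ.1 y := by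
    funext y
    exact Complex.coe_smul _ _
  rw [e, fderiv_fun_smul h1 h2, smul_comm (f x : ℂ), ← smul_sub]
  congr 1
  simp only [add_apply, smul_apply,
    ContinuousLinearMap.smulRight_apply, Complex.coe_smul]
  abel

/-- Symmetry of the second derivative of a smooth function. -/
theorem pOp_comm (ħ : ℝ) (i j : Fin 3) : Commute (pOp ħ i) (pOp ħ j) := by
  have h : ∀ ψ : WaveFn, derivEnd i (derivEnd j ψ) = derivEnd j (derivEnd i ψ) := by
    intro ψ
    refine WaveFn.ext' fun x => ?_
    have hs : IsSymmSndFDerivAt ℝ ψ.1 x :=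
      (ψ.2.1.contDiffAt).isSymmSndFDerivAt (by
        simpa using WithTop.coe_le_coe.mpr (le_top : (2 : ℕ∞) ≤ ⊤))
    have hd : DifferentiableAt ℝ (fderiv ℝ ψ.1) x :=
      (ψ.2.1.fderiv_right (m := ∞) (by simp)).differentiable (by simp) x
    have key : ∀ v w : Space, fderiv ℝ (fun y => fderiv ℝ ψ.1 y w) x v =
        fderiv ℝ (fderiv ℝ ψ.1) x v w := by
      intro v w
      rw [fderiv_clm_apply hd (differentiableAt_const _)]
      simp
    change fderiv ℝ (fun y => fderiv ℝ ψ.1 y (EuclideanSpace.single j 1)) x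
      (EuclideanSpace.single i 1) = fderiv ℝ (fun y => fderiv ℝ ψ.1 y (EuclideanSpace.single i 1)) x
      (EuclideanSpace.single j 1)
    rw [key, key, hs.eq]
  refine Op.ext' fun ψ => ?_
  change (-(Complex.I * ħ)) • derivEnd i ((-(Complex.I * ħ)) • derivEnd j ψ) =
    (-(Complex.I * ħ)) • derivEnd j ((-(Complex.I * ħ)) • derivEnd i ψ)
  rw [map_smul, map_smul, h]

theorem spinOp_mul (M N : Matrix (Fin 2) (Fin 2) ℂ) : spinOp M * spinOp N = spinOp (M * N) := by
  refine Op.ext' fun ψ => WaveFn.ext' fun x => ?_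
  change Matrix.toEuclideanLin M (Matrix.toEuclideanLin N (ψ.1 x)) =
    Matrix.toEuclideanLin (M * N) (ψ.1 x)
  simp [Matrix.toLpLin_apply]

theorem spinOp_smul (z : ℂ) (M : Matrix (Fin 2) (Fin 2) ℂ) :
    spinOp (z • M) = algebraMap ℂ Op z * spinOp M := by
  refine Op.ext' fun ψ => WaveFn.ext' fun x => ?_
  change Matrix.toEuclideanLin (z • M) (ψ.1 x) = z • Matrix.toEuclideanLin M (ψ.1 x)
  rw [map_smul, LinearMap.smul_apply]

theorem spinOp_one : spinOp 1 = 1 := by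
  refine Op.ext' fun ψ => WaveFn.ext' fun x => ?_
  change Matrix.toEuclideanLin 1 (ψ.1 x) = ψ.1 x
  simp

theorem spinOp_comm_mulOp (M : Matrix (Fin 2) (Fin 2) ℂ) (f : Space → ℝ) (hf : ContDiff ℝ ∞ f) :
    Commute (spinOp M) (mulOp f hf) :=
  Op.ext' fun ψ => WaveFn.ext' fun x => map_smul (Matrix.toEuclideanLin M) (f x : ℂ) (ψ.1 x)

theorem spinOp_comm_pOp (M : Matrix (Fin 2) (Fin 2) ℂ) (ħ : ℝ) (i : Fin 3) :
    Commute (spinOp M) (pOp ħ i) := by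
  refine Op.ext' fun ψ => WaveFn.ext' fun x => ?_
  let L := ((Matrix.toEuclideanLin M).restrictScalars ℝ).toContinuousLinearMap
  change Matrix.toEuclideanLin M ((-(Complex.I * ħ)) • fderiv ℝ ψ.1 x (EuclideanSpace.single i 1)) =
    (-(Complex.I * ħ)) • fderiv ℝ (fun y => L (ψ.1 y)) x (EuclideanSpace.single i 1)
  have h2 : DifferentiableAt ℝ ψ.1 x := ψ.2.1.differentiable (by simp) x
  rw [map_smul]
  congr 1
  have := L.hasFDerivAt.comp x h2.hasFDerivAt
  rw [show (fun y => L (ψ.1 y)) = L ∘ ψ.1 from rfl, this.fderiv]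
  rfl

/-! ## The Pauli algebra -/

theorem lift_commute {S T S' T' : Op} (h1 : Commute S S') (h2 : Commute S T') (h3 : Commute T S') :
    Commute (lift S T) (lift S' T') := by
  rw [Commute, SemiconjBy, lift_mul, lift_mul, h1.eq, h2.eq, h3.eq, add_comm]

theorem σ_mul_of {M : Matrix (Fin 2) (Fin 2) ℂ} {i j : Fin 3} (h : pauli i * pauli j = M) :
    σ i * σ j = lift (spinOp M) 0 := by
  rw [σ, σ, lift_mul, spinOp_mul, h]
  simp

theorem scal_mul_lift (z : ℂ) (S T : Op) :
    scal z * lift S T = lift (algebraMap ℂ Op z * S) (algebraMap ℂ Op z * T) := by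
  rw [scal_eq_lift, lift_mul]
  simp

theorem σ_mul_self (i : Fin 3) : σ i * σ i = 1 := by
  rw [σ_mul_of (M := 1), spinOp_one, ← scal_one, scal_eq_lift, map_one]
  fin_cases i <;> ext a b <;> fin_cases a <;> fin_cases b <;>
    simp [pauli, Matrix.mul_apply]

theorem σ_mul_σ {i j k : Fin 3} {z : ℂ} (h : pauli i * pauli j = z • pauli k) :
    σ i * σ j = scal z * σ k := by
  rw [σ_mul_of h, spinOp_smul, σ, scal_mul_lift, mul_zero]

theorem σ_zero_one : σ 0 * σ 1 = scal Complex.I * σ 2 := σ_mul_σ (by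
  ext a b; fin_cases a <;> fin_cases b <;> simp [pauli])

theorem σ_one_two : σ 1 * σ 2 = scal Complex.I * σ 0 := σ_mul_σ (by
  ext a b; fin_cases a <;> fin_cases b <;> simp [pauli])

theorem σ_two_zero : σ 2 * σ 0 = scal Complex.I * σ 1 := σ_mul_σ (by
  ext a b; fin_cases a <;> fin_cases b <;> simp [pauli])

theorem σ_one_zero : σ 1 * σ 0 = -(scal Complex.I * σ 2) := by
  rw [← neg_mul, ← scal_neg]
  exact σ_mul_σ (by ext a b; fin_cases a <;> fin_cases b <;> simp [pauli])

theorem σ_two_one : σ 2 * σ 1 = -(scal Complex.I * σ 0) := by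
  rw [← neg_mul, ← scal_neg]
  exact σ_mul_σ (by ext a b; fin_cases a <;> fin_cases b <;> simp [pauli])

theorem σ_zero_two : σ 0 * σ 2 = -(scal Complex.I * σ 1) := by
  rw [← neg_mul, ← scal_neg]
  exact σ_mul_σ (by ext a b; fin_cases a <;> fin_cases b <;> simp [pauli])

/-- Only the spin has to commute with `a`. The components of `a` and `b` may fail to commute, so
`cross a a` can be nonzero; this is the source of the magnetic term in (σ·π)². -/
theorem dot_σ_mul_dot_σ {a : Fin 3 → Ser} (ha : ∀ i j, Commute (σ i) (a j)) (b : Fin 3 → Ser) :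
    dot σ a * dot σ b = dot a b + scal Complex.I * dot σ (cross a b) := by
  have h : ∀ i j, σ i * a i * (σ j * b j) = σ i * σ j * (a i * b j) := fun i j => by
    calc _ = σ i * (a i * σ j) * b j := by noncomm_ring
      _ = _ := by rw [← (ha j i).eq]; noncomm_ring
  have h' : dot σ a * dot σ b = ∑ i, ∑ j, σ i * σ j * (a i * b j) := by
    rw [dot, dot, Finset.sum_mul_sum]
    exact Finset.sum_congr rfl fun i _ => Finset.sum_congr rfl fun j _ => h i j
  rw [h']
  simp only [dot, cross, Fin.sum_univ_three, σ_mul_self, σ_zero_one, σ_zero_two, σ_one_zero,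
    σ_one_two, σ_two_zero, σ_two_one, Matrix.cons_val_zero, Matrix.cons_val_one, Matrix.cons_val]
  noncomm_ring

theorem dag_σ (i : Fin 3) : dag (σ i) = σ i := by
  rw [σ, dag_lift, star_spinOp, star_zero]
  congr 2
  fin_cases i <;> ext a b <;> fin_cases a <;> fin_cases b <;> simp [pauli]

/-! ## Fields and kinematic momenta -/

theorem field_eq (F : Fin 3 → ℝ) (i : Fin 3) : field F i = eps * scal (F i) := by
  rw [field, eps, scal_eq_lift, lift_mul]
  simp

theorem field_comm (F : Fin 3 → ℝ) (i : Fin 3) (x : Ser) : Commute (field F i) x := by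
  rw [field_eq]
  exact (eps_comm x).mul_left (scal_comm _ x)

theorem first_field (F : Fin 3 → ℝ) (i : Fin 3) : IsFirst (field F i) := ⟨_, field_eq F i⟩

theorem dag_field (F : Fin 3 → ℝ) (i : Fin 3) : dag (field F i) = field F i := by
  rw [field, dag_lift, star_zero, star_algebraMap, Complex.conj_ofReal]

theorem dag_dot_σ {a : Fin 3 → Ser} (ha : ∀ i, Commute (σ i) (a i)) (hd : ∀ i, dag (a i) = a i) :
    dag (dot σ a) = dot σ a := by
  simp only [dot, Fin.sum_univ_three, dag_add, dag_mul, dag_σ, hd, (ha _).eq]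

theorem first_dot_σ {a : Fin 3 → Ser} (ha : ∀ i, IsFirst (a i)) : IsFirst (dot σ a) := by
  simp only [dot, Fin.sum_univ_three]
  exact (((ha 0).mul_left _).add ((ha 1).mul_left _)).add ((ha 2).mul_left _)

theorem σ_comm_pOp (i j : Fin 3) (ħ : ℝ) : Commute (σ i) (lift (pOp ħ j) 0) :=
  lift_commute (spinOp_comm_pOp _ _ _) (Commute.zero_right _) (Commute.zero_left _)

theorem σ_comm_A (P : Potentials) (i j : Fin 3) : Commute (σ i) (P.A j) :=
  lift_commute (spinOp_comm_mulOp _ _ _) (spinOp_comm_mulOp _ _ _) (Commute.zero_left _)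

theorem σ_comm_φ (P : Potentials) (i : Fin 3) : Commute (σ i) P.φ :=
  lift_commute (spinOp_comm_mulOp _ _ _) (spinOp_comm_mulOp _ _ _) (Commute.zero_left _)

theorem A_comm_A (P : Potentials) (i j : Fin 3) : Commute (P.A i) (P.A j) :=
  lift_commute (mulOp_mul_comm _ _ _ _) (mulOp_mul_comm _ _ _ _) (mulOp_mul_comm _ _ _ _)

theorem φ_comm_A (P : Potentials) (j : Fin 3) : Commute P.φ (P.A j) :=
  lift_commute (mulOp_mul_comm _ _ _ _) (mulOp_mul_comm _ _ _ _) (mulOp_mul_comm _ _ _ _)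

theorem kinMom_eq (ħ q : ℝ) (P : Potentials) (i : Fin 3) :
    kinMom ħ q P i = lift (pOp ħ i) 0 - mon q 1 * P.A i := by
  rw [kinMom, scal_eq_mon, cinv_eq_mon, mon_mul_mon, mul_one, zero_add]

theorem σ_comm_kinMom (ħ q : ℝ) (P : Potentials) (i j : Fin 3) :
    Commute (σ i) (kinMom ħ q P j) := by
  rw [kinMom_eq]
  exact (σ_comm_pOp i j ħ).sub_right ((mon_comm _ _ _).symm.mul_right (σ_comm_A P i j))

theorem ordGE_kinMom (ħ q : ℝ) (P : Potentials) (i : Fin 3) : OrdGE 0 (kinMom ħ q P i) := by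
  rw [kinMom_eq]
  exact (ordGE_lift _ _).sub ((ordGE_mon _ _).mul_of_le (ordGE_lift _ _) (by norm_num))

theorem dag_φ (P : Potentials) : dag P.φ = P.φ := by
  rw [Potentials.φ, dag_lift, star_mulOp, star_mulOp]

theorem dag_kinMom (ħ q : ℝ) (P : Potentials) (i : Fin 3) :
    dag (kinMom ħ q P i) = kinMom ħ q P i := by
  rw [kinMom_eq, dag_sub, dag_mul, dag_mon, Complex.conj_ofReal, Potentials.A, dag_lift, dag_lift, star_mulOp,
    star_mulOp, star_pOp, star_zero, (mon_comm _ _ _).eq]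

theorem lift_pOp_commutator (ħ : ℝ) (i : Fin 3) {f g : Space → ℝ} (hf : ContDiff ℝ ∞ f)
    (hg : ContDiff ℝ ∞ g) :
    lift (pOp ħ i) 0 * lift (mulOp f hf) (mulOp g hg) -
      lift (mulOp f hf) (mulOp g hg) * lift (pOp ħ i) 0 =
      scal (-(Complex.I * ħ)) *
        lift (mulOp (pd i f) (contDiff_pd hf i)) (mulOp (pd i g) (contDiff_pd hg i)) := by
  rw [lift_mul, lift_mul, lift_sub, scal_mul_lift, ← pOp_mulOp ħ i hf, ← pOp_mulOp ħ i hg]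
  simp

/-- The [p, p] and [A, A] terms vanish and the two [p, A] terms form a component of the curl, whose
ε⁰ part is zero. -/
theorem kinMom_commutator (ħ q : ℝ) (P : Potentials) (i j : Fin 3) {b : ℝ}
    (h0 : ∀ x, pd i (P.A₀ j) x - pd j (P.A₀ i) x = 0)
    (h1 : ∀ x, pd i (P.A₁ j) x - pd j (P.A₁ i) x = b) :
    kinMom ħ q P i * kinMom ħ q P j - kinMom ħ q P j * kinMom ħ q P i =
      mon (Complex.I * ħ * q) 1 * lift 0 (algebraMap ℂ Op b) := by
  have e1 := lift_pOp_commutator ħ i (P.smooth_A₀ j) (P.smooth_A₁ j)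
  have e2 := lift_pOp_commutator ħ j (P.smooth_A₀ i) (P.smooth_A₁ i)
  change _ * P.A j - P.A j * _ = _ at e1
  change _ * P.A i - P.A i * _ = _ at e2
  have e3 : lift (pOp ħ i) 0 * lift (pOp ħ j) 0 = lift (pOp ħ j) 0 * lift (pOp ħ i) 0 :=
    lift_commute (pOp_comm ħ i j) (Commute.zero_right _) (Commute.zero_left _)
  have e4 := (A_comm_A P i j).eq
  have hc : ∀ x, x * mon q 1 = mon q 1 * x := fun x => (mon_comm _ _ x).eq.symm
  have e5 : ∀ x, mon q 1 * (scal (-(Complex.I * ħ)) * x) = -(mon (Complex.I * ħ * q) 1 * x) := by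
    intro x
    rw [← mul_assoc, scal_eq_mon, mon_mul_mon, ← neg_mul (mon _ _), mon_neg]
    congr 2
    ring
  rw [kinMom_eq, kinMom_eq]
  generalize lift (pOp ħ i) 0 = pi at *
  generalize lift (pOp ħ j) 0 = pj at *
  calc _ = (pi * pj - pj * pi) - (pi * mon q 1 * P.A j - mon q 1 * P.A j * pi)
          + (pj * mon q 1 * P.A i - mon q 1 * P.A i * pj)
          + (mon q 1 * (P.A i * mon q 1) * P.A j - mon q 1 * (P.A j * mon q 1) * P.A i) := by
        noncomm_ring
    _ = -(mon q 1 * (pi * P.A j - P.A j * pi)) + mon q 1 * (pj * P.A i - P.A i * pj)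
          + mon q 1 * mon q 1 * (P.A i * P.A j - P.A j * P.A i) := by
        rw [hc pi, hc pj, hc (P.A i), hc (P.A j), e3]; noncomm_ring
    _ = mon (Complex.I * ħ * q) 1 * (lift (mulOp _ (contDiff_pd (P.smooth_A₀ j) i))
          (mulOp _ (contDiff_pd (P.smooth_A₁ j) i)) -
          lift (mulOp _ (contDiff_pd (P.smooth_A₀ i) j))
          (mulOp _ (contDiff_pd (P.smooth_A₁ i) j))) := by
        rw [e1, e2, e4, e5, e5]; noncomm_ring
    _ = _ := by
        rw [lift_sub, mulOp_sub, mulOp_sub, mulOp_eq_algebraMap _ (r := 0) h0,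
          mulOp_eq_algebraMap _ h1, Complex.ofReal_zero, map_zero]

section

variable {P : Potentials} {E B : Fin 3 → ℝ} (hP : P.HasFields E B) (ħ q : ℝ)
include hP

theorem cross_kinMom (i : Fin 3) :
    cross (kinMom ħ q P) (kinMom ħ q P) i = mon (Complex.I * ħ * q) 1 * field B i := by
  have h0 := fun x => congrFun (hP x).2.2.1
  have h1 := fun x => congrFun (hP x).2.2.2
  fin_cases i
  · exact kinMom_commutator ħ q P 1 2 (fun x => h0 x 0) (fun x => h1 x 0)
  · exact kinMom_commutator ħ q P 2 0 (fun x => h0 x 1) (fun x => h1 x 1)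
  · exact kinMom_commutator ħ q P 0 1 (fun x => h0 x 2) (fun x => h1 x 2)

theorem φ_commutator (i : Fin 3) :
    P.φ * kinMom ħ q P i - kinMom ħ q P i * P.φ = -(scal (Complex.I * ħ) * field E i) := by
  have e1 := lift_pOp_commutator ħ i P.smooth_φ₀ P.smooth_φ₁
  have h0 : ∀ x, pd i P.φ₀ x = (0 : ℝ) := fun x => neg_eq_zero.mp (congrFun (hP x).1 i)
  have h1 : ∀ x, pd i P.φ₁ x = -E i := fun x => by
    rw [← congrFun (hP x).2.1 i, negGrad, neg_neg]
  rw [mulOp_eq_algebraMap _ h0, mulOp_eq_algebraMap _ h1] at e1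
  change _ * P.φ - P.φ * _ = _ at e1
  have e2 := (φ_comm_A P i).eq
  have e3 := (mon_comm q 1 P.φ).eq
  rw [kinMom_eq]
  calc _ = -(lift (pOp ħ i) 0 * P.φ - P.φ * lift (pOp ħ i) 0) - (P.φ * mon q 1) * P.A i +
        mon q 1 * (P.A i * P.φ) := by noncomm_ring
    _ = -(lift (pOp ħ i) 0 * P.φ - P.φ * lift (pOp ħ i) 0) := by
      rw [← e3, ← e2]; noncomm_ring
    _ = _ := by
      rw [e1, field, scal_mul_lift, scal_mul_lift]
      simp

/-- The ε⁰ part of the potential has zero gradient on all of ℝ³ and is therefore a constant, hence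
central. -/
theorem φ_eq : ∃ v₀ v₁, P.φ = v₀ + v₁ ∧ (∀ x, Commute v₀ x) ∧ IsFirst v₁ := by
  have h0 : ∀ x, P.φ₀ x = P.φ₀ 0 := by
    intro x
    refine is_const_of_fderiv_eq_zero (𝕜 := ℝ) (P.smooth_φ₀.differentiable (by simp)) ?_ x 0
    intro y
    refine ContinuousLinearMap.coe_injective
      ((EuclideanSpace.basisFun (Fin 3) ℝ).toBasis.ext fun i => ?_)
    have : pd i P.φ₀ y = (0 : ℝ) := neg_eq_zero.mp (congrFun (hP y).1 i)
    simpa [pd] using this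
  refine ⟨scal (P.φ₀ 0 : ℝ), eps * lift (mulOp P.φ₁ P.smooth_φ₁) 0, ?_, scal_comm _, _, rfl⟩
  rw [Potentials.φ, mulOp_eq_algebraMap _ h0, scal_eq_lift, eps, lift_mul, lift_add]
  simp

end

/-! ### Scalar products with σ and with the constant fields -/

theorem dot_σ_mul_left {C : Ser} (hC : ∀ i, Commute (σ i) C) (x : Fin 3 → Ser) :
    dot σ (fun i => C * x i) = C * dot σ x := by
  simp only [dot, Finset.mul_sum]
  exact Finset.sum_congr rfl fun i _ => by rw [← mul_assoc, (hC i).eq, mul_assoc]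

theorem dot_σ_mon (z : ℂ) (n : ℤ) (x : Fin 3 → Ser) :
    dot σ (fun i => mon z n * x i) = mon z n * dot σ x :=
  dot_σ_mul_left (fun i => (mon_comm z n (σ i)).symm) x

theorem dot_σ_sub (x y : Fin 3 → Ser) : dot σ (fun i => x i - y i) = dot σ x - dot σ y := by
  simp only [dot, mul_sub, Finset.sum_sub_distrib]

theorem ordGE_dot {a b : ℤ} {x y : Fin 3 → Ser} (hx : ∀ i, OrdGE a (x i))
    (hy : ∀ i, OrdGE b (y i)) : OrdGE (a + b) (dot x y) :=
  ordGE_sum _ fun i _ => (hx i).mul (hy i)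

theorem ordGE_σ (i : Fin 3) : OrdGE 0 (σ i) := ordGE_lift _ _

theorem ordGE_field (F : Fin 3 → ℝ) (i : Fin 3) : OrdGE 0 (field F i) := ordGE_lift _ _

theorem commute_dot_σ_field {x : Ser} (h : ∀ i, Commute x (σ i)) (F : Fin 3 → ℝ) :
    Commute x (dot σ (field F)) := by
  simp only [dot, Fin.sum_univ_three]
  exact (((h 0).mul_right (field_comm F 0 x).symm).add_right
    ((h 1).mul_right (field_comm F 1 x).symm)).add_right ((h 2).mul_right (field_comm F 2 x).symm)

theorem commute_dot {x : Ser} {a b : Fin 3 → Ser} (ha : ∀ i, Commute x (a i))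
    (hb : ∀ i, Commute x (b i)) : Commute x (dot a b) := by
  simp only [dot, Fin.sum_univ_three]
  exact (((ha 0).mul_right (hb 0)).add_right ((ha 1).mul_right (hb 1))).add_right
    ((ha 2).mul_right (hb 2))

theorem dot_field_comm (F : Fin 3 → ℝ) (a : Fin 3 → Ser) : dot (field F) a = dot a (field F) :=
  Finset.sum_congr rfl fun i _ => (field_comm F i (a i)).eq

theorem cross_field_comm (F : Fin 3 → ℝ) (a : Fin 3 → Ser) (i : Fin 3) :
    cross (field F) a i = -cross a (field F) i := by
  fin_cases i <;> simp [cross, (field_comm F _ _).eq]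

theorem first_dot_field (F : Fin 3 → ℝ) (a : Fin 3 → Ser) : IsFirst (dot a (field F)) := by
  simp only [dot, Fin.sum_univ_three]
  exact (((first_field F 0).mul_left _).add ((first_field F 1).mul_left _)).add
    ((first_field F 2).mul_left _)

theorem first_cross_field (F : Fin 3 → ℝ) (a : Fin 3 → Ser) (i : Fin 3) :
    IsFirst (cross a (field F) i) := by
  fin_cases i
  all_goals exact ((first_field F _).mul_left _).sub ((first_field F _).mul_left _)

/-- Field components are central, so reversing the factors of the Pauli identity only flips the
vector product. Comparing both orders, commutators yield vector products and anticommutators scalar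
products. -/
theorem dot_σ_field_mul (F : Fin 3 → ℝ) (a : Fin 3 → Ser) :
    dot σ (field F) * dot σ a =
      dot a (field F) - scal Complex.I * dot σ (cross a (field F)) := by
  rw [dot_σ_mul_dot_σ fun i j => (field_comm F j (σ i)).symm, dot_field_comm,
    funext (cross_field_comm F a)]
  simp only [dot, mul_neg, Finset.sum_neg_distrib, sub_eq_add_neg]

/-- The inverses differ by x⁻¹(y - x)y⁻¹, which is first order and annihilates `z`. This allows E to
be replaced by γ in front of field terms. -/
theorem inverse_mul_first {x y z : Ser} (hx : IsUnit x) (hy : IsUnit y) (h : IsFirst (x - y))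
    (hz : IsFirst z) : Ring.inverse x * z = Ring.inverse y * z := by
  have h1 := Ring.inverse_mul_cancel _ hx
  have h2 := Ring.mul_inverse_cancel _ hy
  have h3 : (x - y) * (Ring.inverse y * z) = 0 := h.mul_eq_zero (hz.mul_left _)
  calc Ring.inverse x * z = Ring.inverse x * (y * Ring.inverse y) * z := by rw [h2, mul_one]
    _ = Ring.inverse x * x * (Ring.inverse y * z) - Ring.inverse x * ((x - y) *
        (Ring.inverse y * z)) := by noncomm_ring
    _ = _ := by rw [h1, h3, one_mul, mul_zero, sub_zero]

theorem PosLead.mon_mul {y : Ser} (hy : PosLead y) {r : ℝ} (hr : 0 < r) (n : ℤ) :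
    PosLead (mon r n * y) := by
  obtain ⟨s, k, hs, hk, h0⟩ := hy
  refine ⟨r * s, n + k, mul_pos hr hs, ?_, fun l hl => ?_⟩
  · rw [mon, HahnSeries.coeff_single_mul, add_sub_cancel_left, hk, ← (algebraMap ℂ FOp).map_mul,
      Complex.ofReal_mul]
  · rw [mon, HahnSeries.coeff_single_mul, h0 _ (by omega), mul_zero]

/-- When `b` is of first order and commutes with `√(1 + d)`, the square root of `1 + (d - 2b)` is
`√(1 + d) - (√(1 + d))⁻¹ b`. -/
theorem sqrt_sub_first {d b : Ser} (hd : OrdGE 1 d) (hb : OrdGE 1 b) (hb1 : IsFirst b)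
    (hc : Commute d b) :
    sqrt (1 + (d - 2 * b)) = sqrt (1 + d) - Ring.inverse (sqrt (1 + d)) * b := by
  have h := isPosSqrt_sqrt_one_add hd
  have ho : OrdGE 1 (sqrt (1 + d) - scal (1 : ℝ)) := by
    rw [Complex.ofReal_one, scal_one]
    exact ordGE_sqrt_one_add_sub_one hd
  have hg := Ring.mul_inverse_cancel _ h.isUnit
  have hg' := Ring.inverse_mul_cancel _ h.isUnit
  have hgo := ordGE_inverse one_pos ho hg
  have hγb : Commute (sqrt (1 + d)) b := h.commute ((Commute.one_left b).add_left hc)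
  have hsq := h.1
  generalize sqrt (1 + d) = γ at *
  generalize Ring.inverse γ = g at *
  have hz : g * b * (g * b) = 0 := (hb1.mul_left g).mul_eq_zero (hb1.mul_left g)
  refine IsPosSqrt.sqrt_eq ⟨?_, posLead_of_sub one_pos (r := 1) ?_⟩
  · calc _ = γ * γ - γ * g * b - g * (b * γ) + g * b * (g * b) := by noncomm_ring
      _ = γ * γ - γ * g * b - g * γ * b := by rw [hz, ← hγb.eq]; noncomm_ring
      _ = _ := by rw [hg, hg', hsq]; noncomm_ring
  · have : γ - g * b - scal (1 : ℝ) = γ - scal (1 : ℝ) - g * b := by abel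
    rw [this]
    exact ho.sub (hgo.mul hb)

namespace IsPerturbation

/-- The term from moving W past V does not involve a or b and cancels. In the remaining a·X₀ the
generator X₀ may be replaced by `gen u V a₀ b₀`, since the two differ in first order. The zeros are
the variables `a₀`, `b₀` so that `redA m 0 E` and `redB m 0 B` can be inserted. -/
theorem fwTransform_sub {u V a b a₀ b₀ : Ser} (D : IsPerturbation u V a b) (ha : a₀ = 0)
    (hb : b₀ = 0) (D₀ : IsPerturbation u V a₀ b₀) {k : Ser} (hk : ∀ x, Commute k x) :
    fwTransform (gen u V a b) (pertH k u V a b) 0 0 =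
      fwTransform (gen u V a₀ b₀) (pertH k u V a₀ b₀) 0 0 +
        (k * u * (gen u V a b - gen u V a₀ b₀) - k * b + k * a * gen u V a₀ b₀) := by
  subst ha hb
  rw [D.fwTransform_pertH hk, D₀.fwTransform_pertH hk, blockCorr, blockCorr]
  have h : a * (gen u V 0 0 - freeGen u) = 0 := D.first_a.mul_eq_zero D₀.first_gen_sub
  rw [mul_sub, sub_eq_zero] at h
  rw [mul_assoc k a, h]
  noncomm_ring

end IsPerturbation

/-! ## The physical Hamiltonians -/

section

variable {P : Potentials} {E B : Fin 3 → ℝ} (hP : P.HasFields E B) {ħ m q : ℝ} (hm : 0 < m)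

theorem redMom_eq (hm : 0 < m) (π : Fin 3 → Ser) (i : Fin 3) :
    redMom (scal m) c π i = mon (m : ℂ)⁻¹ 1 * π i := by
  have hm' : (m : ℂ) ≠ 0 := by exact_mod_cast hm.ne'
  rw [redMom, scal_eq_mon, c_eq_mon, mon_mul_mon, mul_one, zero_add, inverse_mon hm', neg_neg]

/-- The velocity operator `σ·π/(mc)`. -/
def redU (ħ m q : ℝ) (P : Potentials) : Ser := dot σ (redMom (scal m) c (kinMom ħ q P))

/-- The potential energy in units of `mc²`. -/
def redV (m q : ℝ) (P : Potentials) : Ser := mon (q / m) 2 * P.φ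

/-- The coupling `iμ' σ·E` of the anomalous moment, in units of `mc²`. -/
def redA (m μ : ℝ) (E : Fin 3 → ℝ) : Ser := mon (Complex.I * μ / m) 3 * dot σ (field E)

/-- The coupling `μ' σ·B` of the anomalous moment, in units of `mc²`. -/
def redB (m μ : ℝ) (B : Fin 3 → ℝ) : Ser := mon (μ / m) 3 * dot σ (field B)

include hm

theorem σ_comm_redMom (i j : Fin 3) : Commute (σ i) (redMom (scal m) c (kinMom ħ q P) j) := by
  rw [redMom_eq hm]
  exact (mon_comm _ _ _).symm.mul_right (σ_comm_kinMom ħ q P i j)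

theorem ordGE_redMom (i : Fin 3) : OrdGE 1 (redMom (scal m) c (kinMom ħ q P) i) := by
  rw [redMom_eq hm]
  exact (ordGE_mon _ _).mul_of_le (ordGE_kinMom ħ q P i) (by norm_num)

theorem ordGE_dot_redMom : OrdGE 1 (dot (redMom (scal m) c (kinMom ħ q P))
    (redMom (scal m) c (kinMom ħ q P))) :=
  (ordGE_dot (ordGE_redMom hm) (ordGE_redMom hm)).mono (by norm_num)

theorem redU_eq : redU ħ m q P = mon (m : ℂ)⁻¹ 1 * dot σ (kinMom ħ q P) := by
  rw [redU, funext (redMom_eq hm _), dot_σ_mon]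

theorem dag_redU : dag (redU ħ m q P) = redU ħ m q P :=
  dag_dot_σ (fun i => σ_comm_redMom hm i i) fun i => by
    rw [redMom_eq hm, dag_mul, dag_kinMom, dag_mon, (mon_comm _ _ _).eq, ← Complex.ofReal_inv,
      Complex.conj_ofReal]

theorem redU_mul_field (F : Fin 3 → ℝ) :
    redU ħ m q P * dot σ (field F) = dot (redMom (scal m) c (kinMom ħ q P)) (field F) +
      scal Complex.I * dot σ (cross (redMom (scal m) c (kinMom ħ q P)) (field F)) :=
  dot_σ_mul_dot_σ (σ_comm_redMom hm) _

/-- The common factor is mc². Dividing by it leaves powers 1, 2 and 3 of 1/c in the kinetic,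
potential and anomalous terms, the last because μ' = μ''/c. -/
theorem diracPauliH_eq (μ : ℝ) :
    diracPauliH ħ m q (scal μ * cinv) P E B =
      pertH (mon m (-2)) (redU ħ m q P) (redV m q P) (redA m μ E) (redB m μ B) := by
  have hm' : (m : ℂ) ≠ 0 := by exact_mod_cast hm.ne'
  have hk : scal m * c ^ 2 = mon m (-2) := by
    rw [scal_eq_mon, c_eq_mon, mon_pow, mon_mul_mon]
    norm_num
  have hu : mon m (-2) * redU ħ m q P = c * dot σ (kinMom ħ q P) := by
    rw [redU_eq hm, ← mul_assoc, mon_mul_mon, c_eq_mon, mul_inv_cancel₀ hm']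
    norm_num
  have hV : mon m (-2) * redV m q P = scal q * P.φ := by
    rw [redV, ← mul_assoc, mon_mul_mon, scal_eq_mon, mul_div_cancel₀ _ hm']
    norm_num
  have hA : mon m (-2) * redA m μ E = scal μ * cinv * (scal Complex.I * dot σ (field E)) := by
    rw [redA, ← mul_assoc, mon_mul_mon, scal_eq_mon, scal_eq_mon, cinv_eq_mon, ← mul_assoc,
      mon_mul_mon, mon_mul_mon, mul_div_cancel₀ _ hm', mul_comm Complex.I]
    norm_num
  have hB : mon m (-2) * redB m μ B = scal μ * cinv * dot σ (field B) := by
    rw [redB, ← mul_assoc, mon_mul_mon, scal_eq_mon, cinv_eq_mon, mon_mul_mon,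
      mul_div_cancel₀ _ hm']
    norm_num
  have hπ : ∑ i, kinMom ħ q P i * σ i = dot σ (kinMom ħ q P) :=
    Finset.sum_congr rfl fun i _ => (σ_comm_kinMom ħ q P i i).eq.symm
  have hF : ∀ F : Fin 3 → ℝ, ∑ i, field F i * σ i = dot σ (field F) := fun F =>
    Finset.sum_congr rfl fun i _ => (field_comm F i (σ i)).eq
  rw [diracPauliH, diracH, hk, pertH]
  simp only [mul_add, mul_sub, hu, hV, hA, hB]
  ext i j : 2
  fin_cases i <;> fin_cases j <;>
    simp [β, α, spinMat, Matrix.sum_apply, Finset.sum_neg_distrib, hπ, hF]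
  · noncomm_ring
  · noncomm_ring

include hP

/-- The product π × π is not zero but a multiple of εB. The factor 2 is split off to fit
`sqrt_sub_first`. -/
theorem redU_sq : redU ħ m q P * redU ħ m q P =
    dot (redMom (scal m) c (kinMom ħ q P)) (redMom (scal m) c (kinMom ħ q P)) -
      2 * (mon (q * ħ / (2 * m ^ 2)) 3 * dot σ (field B)) := by
  have h : ∀ i, cross (redMom (scal m) c (kinMom ħ q P)) (redMom (scal m) c (kinMom ħ q P)) i =
      mon (Complex.I * ħ * q * (m : ℂ)⁻¹ ^ 2) 3 * field B i := by
    intro i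
    have h1 : ∀ x y : Ser, mon (m : ℂ)⁻¹ 1 * x * (mon (m : ℂ)⁻¹ 1 * y) =
        mon ((m : ℂ)⁻¹ ^ 2) 2 * (x * y) := fun x y => by
      rw [mul_assoc, ← mul_assoc x, ← (mon_comm _ _ x).eq, mul_assoc, ← mul_assoc, mon_mul_mon,
        pow_two]
      norm_num
    have h2 : cross (redMom (scal m) c (kinMom ħ q P)) (redMom (scal m) c (kinMom ħ q P)) i =
        mon ((m : ℂ)⁻¹ ^ 2) 2 * cross (kinMom ħ q P) (kinMom ħ q P) i := by
      rw [funext (redMom_eq hm _)]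
      fin_cases i <;> simp [cross, h1, mul_sub]
    rw [h2, cross_kinMom hP, ← mul_assoc, mon_mul_mon, mul_comm]
    norm_num
  rw [redU, dot_σ_mul_dot_σ (σ_comm_redMom hm), funext h, dot_σ_mon, ← mul_assoc,
    scal_eq_mon Complex.I, mon_mul_mon, ← mul_assoc 2, two_mul_mon, sub_eq_add_neg, ← neg_mul, mon_neg]
  congr 3
  have hm' : (m : ℂ) ≠ 0 := by exact_mod_cast hm.ne'
  field_simp
  rw [Complex.I_sq]
  ring

theorem redV_commutator : redV m q P * redU ħ m q P - redU ħ m q P * redV m q P =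
    -(mon (Complex.I * ħ * q / m ^ 2) 3 * dot σ (field E)) := by
  have hm' : (m : ℂ) ≠ 0 := by exact_mod_cast hm.ne'
  have h : P.φ * dot σ (kinMom ħ q P) - dot σ (kinMom ħ q P) * P.φ =
      -(scal (Complex.I * ħ) * dot σ (field E)) := by
    have e : ∀ i, P.φ * (σ i * kinMom ħ q P i) - σ i * kinMom ħ q P i * P.φ =
        -(scal (Complex.I * ħ) * (σ i * field E i)) := fun i => by
      calc _ = P.φ * σ i * kinMom ħ q P i - σ i * (kinMom ħ q P i * P.φ) := by noncomm_ring
        _ = σ i * (P.φ * kinMom ħ q P i - kinMom ħ q P i * P.φ) := by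
          rw [← (σ_comm_φ P i).eq]; noncomm_ring
        _ = -(σ i * scal (Complex.I * ħ) * field E i) := by
          rw [φ_commutator hP]; noncomm_ring
        _ = _ := by rw [← (scal_comm _ (σ i)).eq, mul_assoc]
    simp only [dot, Finset.mul_sum, Finset.sum_mul, ← Finset.sum_sub_distrib, e,
      Finset.sum_neg_distrib]
  rw [redV, redU_eq hm]
  have h1 := (mon_comm (m : ℂ)⁻¹ 1 P.φ).eq
  have h2 := (mon_comm (q / m : ℂ) 2 (dot σ (kinMom ħ q P))).eq
  calc _ = mon (q / m : ℂ) 2 * (P.φ * mon (m : ℂ)⁻¹ 1) * dot σ (kinMom ħ q P) -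
        mon (m : ℂ)⁻¹ 1 * (dot σ (kinMom ħ q P) * mon (q / m : ℂ) 2) * P.φ := by noncomm_ring
    _ = mon (m : ℂ)⁻¹ 1 * mon (q / m : ℂ) 2 *
        (P.φ * dot σ (kinMom ħ q P) - dot σ (kinMom ħ q P) * P.φ) := by
      rw [← h1, ← h2, ← mul_assoc, ← (mon_comm (m : ℂ)⁻¹ 1 (mon (q / m : ℂ) 2)).eq]
      noncomm_ring
    _ = _ := by
      rw [h, mul_neg, ← mul_assoc, scal_eq_mon, mon_mul_mon, mon_mul_mon]
      congr 3
      field_simp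

/-- (π/mc)² commutes with the spin and with constant fields; the magnetic term of u² is first order
and so commutes with another first-order element. -/
theorem comm_redU_sq_dot_σ_field (F : Fin 3 → ℝ) :
    Commute (redU ħ m q P * redU ħ m q P) (dot σ (field F)) := by
  rw [redU_sq hP hm, ← mul_assoc, two_mul_mon]
  refine Commute.sub_left (commute_dot_σ_field (fun i => (commute_dot (σ_comm_redMom hm i)
    (σ_comm_redMom hm i)).symm) F) ?_
  exact ((first_dot_σ (first_field B)).mul_left _).commute (first_dot_σ (first_field F))

theorem isPerturbation (μ : ℝ) :
    IsPerturbation (redU ħ m q P) (redV m q P) (redA m μ E) (redB m μ B) where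
  ord_u := ordGE_dot (a := 0) ordGE_σ (ordGE_redMom hm)
  ord_V := (ordGE_mon _ _).mul_of_le (ordGE_lift _ _) (by norm_num)
  ord_a := (ordGE_mon _ _).mul_of_le (ordGE_dot ordGE_σ (ordGE_field E)) (by norm_num)
  ord_b := (ordGE_mon _ _).mul_of_le (ordGE_dot ordGE_σ (ordGE_field B)) (by norm_num)
  dag_u := dag_redU hm
  central_V := by
    obtain ⟨v₀, v₁, h, h₀, h₁⟩ := φ_eq hP
    exact ⟨mon (q / m) 2 * v₀, mon (q / m) 2 * v₁, by rw [redV, h, mul_add],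
      fun x => (mon_comm _ _ x).mul_left (h₀ x), h₁.mul_left _⟩
  first_a := (first_dot_σ (first_field E)).mul_left _
  first_b := (first_dot_σ (first_field B)).mul_left _
  comm_a := (mon_comm _ _ _).symm.mul_right (comm_redU_sq_dot_σ_field hP hm E)
  comm_b := (mon_comm _ _ _).symm.mul_right (comm_redU_sq_dot_σ_field hP hm B)
  comm_V := by
    rw [redV_commutator hP hm]
    exact ((mon_comm _ _ _).symm.mul_right (comm_redU_sq_dot_σ_field hP hm E)).neg_right

end

/-! ### The Lorentz factor and the block in physical variables -/

section

variable {P : Potentials} {E B : Fin 3 → ℝ} (hP : P.HasFields E B) {ħ m q : ℝ} (hm : 0 < m)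

include hm

theorem isPosSqrt_lorentz : IsPosSqrt (lorentz sqrt (scal m) c (kinMom ħ q P))
    (1 + dot (redMom (scal m) c (kinMom ħ q P)) (redMom (scal m) c (kinMom ħ q P))) :=
  isPosSqrt_sqrt_one_add (ordGE_dot_redMom hm)

/-- The radicand is (mc²)²(1 + (π/mc)²), so its root is mc²γ. -/
theorem isPosSqrt_kinetic : IsPosSqrt (mon m (-2) * lorentz sqrt (scal m) c (kinMom ħ q P))
    (scal m ^ 2 * c ^ 4 + c ^ 2 * dot (kinMom ħ q P) (kinMom ħ q P)) := by
  have hm' : (m : ℂ) ≠ 0 := by exact_mod_cast hm.ne'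
  have h := isPosSqrt_lorentz (P := P) (ħ := ħ) (q := q) hm
  refine ⟨?_, h.posLead.mon_mul hm (-2)⟩
  have hd : dot (redMom (scal m) c (kinMom ħ q P)) (redMom (scal m) c (kinMom ħ q P)) =
      mon ((m : ℂ)⁻¹ ^ 2) 2 * dot (kinMom ħ q P) (kinMom ħ q P) := by
    rw [dot, dot, Finset.mul_sum]
    refine Finset.sum_congr rfl fun i _ => ?_
    rw [redMom_eq hm, mul_assoc, ← mul_assoc (kinMom ħ q P i), ← (mon_comm _ _ _).eq, mul_assoc,
      ← mul_assoc, mon_mul_mon, pow_two]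
    norm_num
  have h1 := h.1
  generalize lorentz sqrt (scal m) c (kinMom ħ q P) = γ at *
  calc mon m (-2) * γ * (mon m (-2) * γ) = mon m (-2) * (γ * mon m (-2)) * γ := by noncomm_ring
    _ = mon m (-2) * mon m (-2) * (γ * γ) := by rw [← (mon_comm _ _ γ).eq]; noncomm_ring
    _ = _ := by
      rw [h1, hd, mul_add, mul_one, mon_mul_mon, ← mul_assoc, mon_mul_mon, scal_eq_mon, c_eq_mon,
        mon_pow, mon_pow, mon_pow, mon_mul_mon]
      congr 2
      · norm_num [pow_two]
      · congr 1
        · field_simp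

theorem σ_comm_lorentz (i : Fin 3) :
    Commute (lorentz sqrt (scal m) c (kinMom ħ q P)) (σ i) :=
  (isPosSqrt_lorentz hm).commute ((Commute.one_left _).add_left
    (commute_dot (σ_comm_redMom hm i) (σ_comm_redMom hm i)).symm)

theorem isUnit_one_add_lorentz : IsUnit (1 + lorentz sqrt (scal m) c (kinMom ħ q P)) := by
  refine (posLead_of_sub two_pos (r := 2) ?_).isUnit
  have : (1 + lorentz sqrt (scal m) c (kinMom ħ q P) - scal (2 : ℝ) : Ser) =
      lorentz sqrt (scal m) c (kinMom ħ q P) - 1 := by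
    rw [show ((2 : ℝ) : ℂ) = 2 by norm_num, scal_two, ← one_add_one_eq_two]
    noncomm_ring
  rw [this]
  exact ordGE_sqrt_one_add_sub_one (ordGE_dot_redMom hm)

include hP

/-- This is `blockCorr_eq` evaluated: [u, [V, u]] and [a, u] give σ·(π × E), and bu + ub gives π·B.
-/
theorem fwTransform_eq (μ : ℝ) :
    fwTransform (gen (redU ħ m q P) (redV m q P) (redA m μ E) (redB m μ B))
        (pertH (mon m (-2)) (redU ħ m q P) (redV m q P) (redA m μ E) (redB m μ B)) 0 0 =
      sqrt (scal m ^ 2 * c ^ 4 + c ^ 2 * dot (kinMom ħ q P) (kinMom ħ q P)) + scal q * P.φ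
        - dot σ (fun i =>
            (mon μ 1 + mon (q * ħ / (2 * m)) 1 *
              Ring.inverse (lorentz sqrt (scal m) c (kinMom ħ q P))) * field B i
            - mon μ 1 * Ring.inverse (lorentz sqrt (scal m) c (kinMom ħ q P) *
                (1 + lorentz sqrt (scal m) c (kinMom ħ q P))) *
                dot (redMom (scal m) c (kinMom ħ q P)) (field B) *
                redMom (scal m) c (kinMom ħ q P) i
            - (mon μ 1 * Ring.inverse (lorentz sqrt (scal m) c (kinMom ħ q P)) +
                mon (q * ħ / (2 * m)) 1 *
                Ring.inverse (lorentz sqrt (scal m) c (kinMom ħ q P) *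
                (1 + lorentz sqrt (scal m) c (kinMom ħ q P)))) *
                cross (redMom (scal m) c (kinMom ħ q P)) (field E) i) := by
  have hm' : (m : ℂ) ≠ 0 := by exact_mod_cast hm.ne'
  have D := isPerturbation hP hm (ħ := ħ) (q := q) μ
  have hγ := isPosSqrt_lorentz (P := P) (ħ := ħ) (q := q) hm
  have hγσ := σ_comm_lorentz (P := P) (ħ := ħ) (q := q) hm
  have hΓu := isUnit_one_add_lorentz (P := P) (ħ := ħ) (q := q) hm
  have hσu := σ_comm_redMom (P := P) (ħ := ħ) (q := q) hm
  have hβ1 : IsFirst (mon (q * ħ / (2 * m ^ 2)) 3 * dot σ (field B)) :=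
    (first_dot_σ (first_field B)).mul_left _
  have hβo : OrdGE 1 (mon (q * ħ / (2 * m ^ 2)) 3 * dot σ (field B)) :=
    (ordGE_mon _ _).mul_of_le (ordGE_dot ordGE_σ (ordGE_field B)) (by norm_num)
  have hβc : Commute (dot (redMom (scal m) c (kinMom ħ q P)) (redMom (scal m) c (kinMom ħ q P)))
      (mon (q * ħ / (2 * m ^ 2)) 3 * dot σ (field B)) :=
    (mon_comm _ _ _).symm.mul_right
      (commute_dot_σ_field (fun i => (commute_dot (hσu i) (hσu i)).symm) B)
  -- The correction to γ is the magnetic coupling of the Dirac moment, the only place where E and γ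
  -- must be distinguished.
  have hE : energy (redU ħ m q P) = lorentz sqrt (scal m) c (kinMom ħ q P) -
      Ring.inverse (lorentz sqrt (scal m) c (kinMom ħ q P)) *
        (mon (q * ħ / (2 * m ^ 2)) 3 * dot σ (field B)) := by
    rw [energy, redU_sq hP hm, sqrt_sub_first (ordGE_dot_redMom hm) hβo hβ1 hβc]
    rfl
  have hEγ : IsFirst (energy (redU ħ m q P) - lorentz sqrt (scal m) c (kinMom ħ q P)) := by
    rw [hE, sub_sub_cancel_left]
    exact (hβ1.mul_left _).neg
  have hs : redU ħ m q P * (redV m q P * redU ħ m q P - redU ħ m q P * redV m q P) -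
      (redV m q P * redU ħ m q P - redU ħ m q P * redV m q P) * redU ħ m q P =
      4 * (mon (q * ħ / (2 * m ^ 2)) 3 *
        dot σ (cross (redMom (scal m) c (kinMom ħ q P)) (field E))) := by
    have h1 := redU_mul_field (P := P) (ħ := ħ) (q := q) hm E
    have h2 := dot_σ_field_mul E (redMom (scal m) c (kinMom ħ q P))
    have h3 := (mon_comm (Complex.I * ħ * q / m ^ 2) 3 (redU ħ m q P)).eq
    rw [redV_commutator hP hm]
    calc _ = -(redU ħ m q P * mon (Complex.I * ħ * q / m ^ 2) 3 * dot σ (field E)) +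
          mon (Complex.I * ħ * q / m ^ 2) 3 * (dot σ (field E) * redU ħ m q P) := by noncomm_ring
      _ = -(mon (Complex.I * ħ * q / m ^ 2) 3 * (2 * scal Complex.I) *
          dot σ (cross (redMom (scal m) c (kinMom ħ q P)) (field E))) := by
        rw [← h3, mul_assoc, h1, redU, h2]
        noncomm_ring
      _ = (2 * (2 * mon (q * ħ / (2 * m ^ 2)) 3)) *
          dot σ (cross (redMom (scal m) c (kinMom ħ q P)) (field E)) := by
        rw [scal_eq_mon Complex.I, two_mul_mon, two_mul_mon, two_mul_mon, mon_mul_mon, ← neg_mul,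
          mon_neg]
        congr 2
        field_simp
        rw [Complex.I_sq]
        ring
      _ = _ := by noncomm_ring
  have hr : redA m μ E * redU ħ m q P - redU ħ m q P * redA m μ E =
      2 * (mon (μ / m) 3 * dot σ (cross (redMom (scal m) c (kinMom ħ q P)) (field E))) := by
    have h1 := redU_mul_field (P := P) (ħ := ħ) (q := q) hm E
    have h2 := dot_σ_field_mul E (redMom (scal m) c (kinMom ħ q P))
    have h3 := (mon_comm (Complex.I * μ / m) 3 (redU ħ m q P)).eq
    rw [redA]
    calc _ = mon (Complex.I * μ / m) 3 * (dot σ (field E) * redU ħ m q P) -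
          redU ħ m q P * mon (Complex.I * μ / m) 3 * dot σ (field E) := by noncomm_ring
      _ = -(mon (Complex.I * μ / m) 3 * (2 * scal Complex.I)) *
          dot σ (cross (redMom (scal m) c (kinMom ħ q P)) (field E)) := by
        rw [← h3, mul_assoc _ (redU ħ m q P), h1, redU, h2]
        noncomm_ring
      _ = (2 * mon (μ / m) 3) *
          dot σ (cross (redMom (scal m) c (kinMom ħ q P)) (field E)) := by
        rw [scal_eq_mon Complex.I, two_mul_mon, two_mul_mon, mon_mul_mon, mon_neg]
        congr 2
        field_simp
        rw [Complex.I_sq]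
        ring
      _ = _ := mul_assoc _ _ _
  have hn : redB m μ B * redU ħ m q P + redU ħ m q P * redB m μ B =
      2 * (mon (μ / m) 3 * dot (redMom (scal m) c (kinMom ħ q P)) (field B)) := by
    have h1 := redU_mul_field (P := P) (ħ := ħ) (q := q) hm B
    have h2 := dot_σ_field_mul B (redMom (scal m) c (kinMom ħ q P))
    have h3 := (mon_comm (μ / m) 3 (redU ħ m q P)).eq
    rw [redB]
    calc _ = mon (μ / m) 3 * (dot σ (field B) * redU ħ m q P) +
          redU ħ m q P * mon (μ / m) 3 * dot σ (field B) := by noncomm_ring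
      _ = _ := by
        rw [← h3, mul_assoc _ (redU ħ m q P), h1, redU, h2]
        noncomm_ring
  -- Because [u, bu + ub] = [u², b] = 0. It moves σ·π to the right of π·B, as in the stated formula.
  have hUn : redU ħ m q P * (mon (μ / m) 3 * dot (redMom (scal m) c (kinMom ħ q P)) (field B)) =
      mon (μ / m) 3 * dot (redMom (scal m) c (kinMom ħ q P)) (field B) * redU ħ m q P := by
    refine isUnit_two.mul_left_cancel ?_
    have hb := D.comm_b.eq
    calc _ = redU ħ m q P *
          (2 * (mon (μ / m) 3 * dot (redMom (scal m) c (kinMom ħ q P)) (field B))) := by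
          noncomm_ring
      _ = 2 * (mon (μ / m) 3 * dot (redMom (scal m) c (kinMom ħ q P)) (field B)) *
          redU ħ m q P := by
        rw [← hn]
        calc _ = redU ħ m q P * redB m μ B * redU ħ m q P +
              redU ħ m q P * redU ħ m q P * redB m μ B := by noncomm_ring
          _ = _ := by rw [hb]; noncomm_ring
      _ = _ := by noncomm_ring
  have hk := fun x => (mon_comm m (-2) x).eq
  have hx1 := (first_dot_σ (first_cross_field E (redMom (scal m) c (kinMom ħ q P))))
  have hx2 := first_dot_field B (redMom (scal m) c (kinMom ħ q P))
  have i1 : ∀ {z}, IsFirst z → Ring.inverse (energy (redU ħ m q P)) * z =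
      Ring.inverse (lorentz sqrt (scal m) c (kinMom ħ q P)) * z := fun hz =>
    inverse_mul_first D.isUnit_energy hγ.isUnit hEγ hz
  have i2 : ∀ {z}, IsFirst z →
      Ring.inverse (energy (redU ħ m q P) * (1 + energy (redU ħ m q P))) * z =
      Ring.inverse (lorentz sqrt (scal m) c (kinMom ħ q P) *
        (1 + lorentz sqrt (scal m) c (kinMom ħ q P))) * z := fun hz => by
    refine inverse_mul_first (D.isUnit_energy.mul D.isUnit_one_add_energy)
      (hγ.isUnit.mul hΓu) ?_ hz
    generalize lorentz sqrt (scal m) c (kinMom ħ q P) = γ at *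
    have : energy (redU ħ m q P) * (1 + energy (redU ħ m q P)) - γ * (1 + γ) =
        (energy (redU ħ m q P) - γ) + energy (redU ħ m q P) * (energy (redU ħ m q P) - γ) +
          (energy (redU ħ m q P) - γ) * γ := by noncomm_ring
    rw [this]
    exact (hEγ.add (hEγ.mul_left _)).add (hEγ.mul_right _)
  have c1 : ∀ i, Commute (σ i) (Ring.inverse (lorentz sqrt (scal m) c (kinMom ħ q P))) :=
    fun i => (commute_inverse hγ.isUnit (hγσ i)).symm
  have c2 : ∀ i, Commute (σ i) (Ring.inverse (lorentz sqrt (scal m) c (kinMom ħ q P) *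
      (1 + lorentz sqrt (scal m) c (kinMom ħ q P)))) := fun i =>
    (commute_inverse (hγ.isUnit.mul hΓu)
      ((hγσ i).mul_left ((Commute.one_left _).add_left (hγσ i)))).symm
  have c3 : ∀ i, Commute (σ i) (dot (redMom (scal m) c (kinMom ħ q P)) (field B)) := fun i =>
    commute_dot (hσu i) fun j => (field_comm B j _).symm
  have c4 : ∀ i (z : ℂ) n, Commute (σ i) (mon z n) := fun i z n => (mon_comm z n _).symm
  rw [D.fwTransform_pertH (mon_comm m (-2)), add_sub_assoc, D.blockCorr_eq hs hr hn, hUn,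
    i2 (hx1.mul_left _), i1 (hx1.mul_left _), i2 ((hx2.mul_left _).mul_right _), hE,
    (isPosSqrt_kinetic hm).sqrt_eq, dot_σ_sub, dot_σ_sub,
    dot_σ_mul_left fun i => (c4 i _ _).add_right ((c4 i _ _).mul_right (c1 i)),
    dot_σ_mul_left fun i => ((c4 i _ _).mul_right (c2 i)).mul_right (c3 i),
    dot_σ_mul_left fun i => ((c4 i _ _).mul_right (c1 i)).add_right ((c4 i _ _).mul_right (c2 i))]
  -- The contraction of σ with π/(mc) is `redU` by definition.
  change _ = _ - (_ - _ * redU ħ m q P - _)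
  have k1 : mon m (-2) * mon (q * ħ / (2 * m ^ 2)) 3 = mon (q * ħ / (2 * m)) 1 := by
    rw [mon_mul_mon]
    congr 1
    field_simp
  have k2 : mon m (-2) * mon (μ / m) 3 = mon μ 1 := by
    rw [mon_mul_mon, mul_div_cancel₀ _ hm']
    norm_num
  have k3 : mon m (-2) * redV m q P = scal q * P.φ := by
    rw [redV, ← mul_assoc, mon_mul_mon, scal_eq_mon, mul_div_cancel₀ _ hm']
    norm_num
  have k4 : ∀ (z : Ser) (w w' : ℂ) n n' x, mon m (-2) * mon w n = mon w' n' →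
      mon m (-2) * (z * (mon w n * x)) = mon w' n' * z * x := fun z w w' n n' x h => by
    rw [← mul_assoc, hk, mul_assoc, ← mul_assoc _ (mon w n), h, ← mul_assoc,
      (mon_comm w' n' z).eq]
  have k5 : mon m (-2) * redB m μ B = mon μ 1 * dot σ (field B) := by
    rw [redB, ← mul_assoc, k2]
  simp only [mul_add, mul_sub, mul_assoc (mon _ _) (dot _ _) (redU _ _ _ _), k3, k5,
    k4 _ _ _ _ _ _ k1, k4 _ _ _ _ _ _ k2]
  noncomm_ring

end

/-! ### Selfadjointness and comparison with the classical Hamiltonian -/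

theorem matDag_pertH {k u V a b : Ser} (hk : ∀ x, Commute k x) (dk : dag k = k) (du : dag u = u)
    (dV : dag V = V) (da : dag a = -a) (db : dag b = b) :
    matDag (pertH k u V a b) = pertH k u V a b := by
  have h : ∀ x, dag (k * x) = k * dag x := fun x => by rw [dag_mul, dk, (hk _).eq]
  ext i j : 2
  fin_cases i <;> fin_cases j <;>
    simp [matDag, pertH, h, dag_add, dag_neg, dag_one, du, dV, da, db, sub_eq_add_neg]

/-- The classical Hamiltonian with spin `(ħ/2) σ`, the spin factor moved into the coefficients. -/
theorem classicalH_eq (ħ m q : ℝ) (φ γm μ' : Ser) (π E B : Fin 3 → Ser)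
    (hμ : scal (ħ / 2) * γm = μ') :
    classicalH sqrt (scal m) c (scal q) φ γm (fun i => scal (ħ / 2) * σ i) π E B =
      sqrt (scal m ^ 2 * c ^ 4 + c ^ 2 * dot π π) + scal q * φ
        - dot σ (fun i =>
            (μ' + scal (ħ / 2) * (scal q * Ring.inverse (scal m * c)) *
              Ring.inverse (lorentz sqrt (scal m) c π)) * B i
            - μ' * Ring.inverse (lorentz sqrt (scal m) c π * (1 + lorentz sqrt (scal m) c π)) *
                dot (redMom (scal m) c π) B * redMom (scal m) c π i
            - (μ' * Ring.inverse (lorentz sqrt (scal m) c π) +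
                scal (ħ / 2) * (scal q * Ring.inverse (scal m * c)) *
                Ring.inverse (lorentz sqrt (scal m) c π * (1 + lorentz sqrt (scal m) c π))) *
                cross (redMom (scal m) c π) E i) := by
  rw [classicalH, orbitH, spinH, sub_eq_add_neg, ← hμ]
  congr 2
  refine Finset.sum_congr rfl fun i _ => ?_
  beta_reduce
  rw [(scal_comm _ (σ i)).eq, mul_assoc]
  congr 1
  simp only [mul_sub, mul_add, add_mul, mul_assoc]

/-- The spin coupling without anomalous moment. -/
theorem dot_σ_spin_zero {γ κ : Ser} {u E B : Fin 3 → Ser} (h1 : IsUnit γ) (h2 : IsUnit (1 + γ))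
    (hγ : ∀ i, Commute γ (σ i)) (hκ : ∀ x, Commute κ x) :
    dot σ (fun i => (0 + κ * Ring.inverse γ) * B i
      - 0 * Ring.inverse (γ * (1 + γ)) * dot u B * u i
      - (0 * Ring.inverse γ + κ * Ring.inverse (γ * (1 + γ))) * cross u E i) =
      κ * Ring.inverse γ * dot σ B -
        κ * (Ring.inverse γ - Ring.inverse (1 + γ)) * dot σ (cross u E) := by
  -- Partial fractions bring the electric coefficient into the form of the Dirac formula.
  have hinv : Ring.inverse (γ * (1 + γ)) = Ring.inverse γ - Ring.inverse (1 + γ) := by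
    refine (h1.mul h2).mul_left_cancel ?_
    have e1 : γ * (1 + γ) * Ring.inverse γ = 1 + γ := by
      rw [show γ * (1 + γ) = (1 + γ) * γ by noncomm_ring, mul_assoc, Ring.mul_inverse_cancel _ h1,
        mul_one]
    rw [Ring.mul_inverse_cancel _ (h1.mul h2), mul_sub, e1, mul_assoc,
      Ring.mul_inverse_cancel _ h2, mul_one, add_sub_cancel_right]
  have c1 : ∀ i, Commute (σ i) (Ring.inverse γ) := fun i => (commute_inverse h1 (hγ i)).symm
  have c2 : ∀ i, Commute (σ i) (Ring.inverse (1 + γ)) := fun i =>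
    (commute_inverse h2 ((Commute.one_left _).add_left (hγ i))).symm
  simp only [hinv, zero_add, zero_mul, sub_zero]
  rw [dot_σ_sub, dot_σ_mul_left fun i => (hκ _).symm.mul_right (c1 i),
    dot_σ_mul_left fun i => (hκ _).symm.mul_right ((c1 i).sub_right (c2 i))]

section

variable {P : Potentials} {E B : Fin 3 → ℝ} {ħ m q : ℝ} (hm : 0 < m)

theorem dag_redV : dag (redV m q P) = redV m q P := by
  rw [redV, dag_mul, dag_φ, dag_mon, (mon_comm _ _ _).eq, ← Complex.ofReal_div,
    Complex.conj_ofReal]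

theorem dag_dot_σ_field (F : Fin 3 → ℝ) : dag (dot σ (field F)) = dot σ (field F) :=
  dag_dot_σ (fun i => (field_comm F i _).symm) (dag_field F)

/-- The factor i makes this coupling antihermitian, so that u + a and u - a are adjoint to each
other. -/
theorem dag_redA (μ : ℝ) : dag (redA m μ E) = -redA m μ E := by
  rw [redA, dag_mul, dag_dot_σ_field, dag_mon, ← (mon_comm _ _ _).eq, ← neg_mul, mon_neg]
  simp [neg_div]

theorem dag_redB (μ : ℝ) : dag (redB m μ B) = redB m μ B := by
  rw [redB, dag_mul, dag_dot_σ_field, dag_mon, ← (mon_comm _ _ _).eq, ← Complex.ofReal_div,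
    Complex.conj_ofReal]

include hm

theorem matDag_pertH_red (μ : ℝ) :
    matDag (pertH (mon m (-2)) (redU ħ m q P) (redV m q P) (redA m μ E) (redB m μ B)) =
      pertH (mon m (-2)) (redU ħ m q P) (redV m q P) (redA m μ E) (redB m μ B) :=
  matDag_pertH (mon_comm _ _) (by rw [dag_mon, Complex.conj_ofReal]) (dag_redU hm) dag_redV
    (dag_redA μ) (dag_redB μ)

theorem isFW_red_iff (hP : P.HasFields E B) (μ : ℝ) (X : Ser) :
    IsFW (pertH (mon m (-2)) (redU ħ m q P) (redV m q P) (redA m μ E) (redB m μ B)) X ↔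
      X = gen (redU ħ m q P) (redV m q P) (redA m μ E) (redB m μ B) := by
  have D := isPerturbation hP hm (ħ := ħ) (q := q) μ
  have hku : IsUnit (mon m (-2)) := isUnit_mon (by exact_mod_cast hm.ne') _
  rw [isFW_iff (matDag_pertH_red hm μ)]
  constructor
  · rintro ⟨h1, h2⟩
    exact (D.riccati_eq_zero_iff (mon_comm _ _) hku h1).mp h2
  · rintro rfl
    exact ⟨D.ord_gen, D.riccati_gen (mon_comm _ _)⟩

end

end

end DiracPauli

/-! ### The main theorem -/

theorem mainTheorem3 (ħ m q μ'' : ℝ) (hm : 0 < m) (P : Potentials) (E B : Fin 3 → ℝ)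
    (hP : P.HasFields E B) :
    let π := kinMom ħ q P
    let Eₒ := field E
    let Bₒ := field B
    let μ' := scal μ'' * cinv
    let H := diracH ħ m q P
    let ℋ := diracPauliH ħ m q μ' P E B
    let u := redMom (scal m) c π
    let γ := lorentz sqrt (scal m) c π
    let κ := scal q * scal ħ * Ring.inverse (2 * scal m * c)
    -- the square roots in the closed form exist as formal series
    IsPosSqrt γ (1 + dot u u) ∧
    IsPosSqrt (sqrt (scal m ^ 2 * c ^ 4 + c ^ 2 * dot π π))
      (scal m ^ 2 * c ^ 4 + c ^ 2 * dot π π) ∧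
    ∃ X 𝒳 : Ser,
      -- `X` and `𝒳` are the unique generators of the two Foldy-Wouthuysen transformations
      (∀ X' : Ser, IsFW H X' ↔ X' = X) ∧
      (∀ 𝒳' : Ser, IsFW ℋ 𝒳' ↔ 𝒳' = 𝒳) ∧
      -- the transformations are unitary
      (fwU X * matDag (fwU X) = 1 ∧ matDag (fwU X) * fwU X = 1) ∧
      (fwU 𝒳 * matDag (fwU 𝒳) = 1 ∧ matDag (fwU 𝒳) * fwU 𝒳 = 1) ∧
      -- the transformed Dirac Hamiltonian
      fwTransform X H 0 0 =
        scal q * P.φ + sqrt (scal m ^ 2 * c ^ 4 + c ^ 2 * dot π π)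
          - κ * Ring.inverse γ * dot σ Bₒ
          + κ * (Ring.inverse γ - Ring.inverse (1 + γ)) * dot σ (cross u Eₒ) ∧
      fwTransform X H 0 0 =
        classicalH sqrt (scal m) c (scal q) P.φ 0 (fun i => scal (ħ / 2) * σ i) π Eₒ Bₒ ∧
      -- the transformed Dirac-Pauli Hamiltonian
      fwTransform 𝒳 ℋ 0 0 =
        sqrt (scal m ^ 2 * c ^ 4 + c ^ 2 * dot π π) + scal q * P.φ
          - dot σ (fun i =>
              (μ' + κ * Ring.inverse γ) * Bₒ i
                - μ' * Ring.inverse (γ * (1 + γ)) * dot u Bₒ * u i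
                - (μ' * Ring.inverse γ + κ * Ring.inverse (γ * (1 + γ))) * cross u Eₒ i) ∧
      (∀ g : ℝ, μ'' = ħ / 2 * g →
        fwTransform 𝒳 ℋ 0 0 =
          classicalH sqrt (scal m) c (scal q) P.φ (scal g * cinv) (fun i => scal (ħ / 2) * σ i)
            π Eₒ Bₒ) ∧
      -- the splitting of the Dirac-Pauli Hamiltonian, and the antihermitian parts
      fwTransform 𝒳 ℋ 0 0 = fwTransform X H 0 0 +
        (c * dot σ π * (𝒳 - X) - μ' * dot σ Bₒ + scal Complex.I * μ' * dot σ Eₒ * X) ∧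
      antiherm (fwTransform X H 0 0) = 0 ∧
      antiherm (c * dot σ π * (𝒳 - X) - μ' * dot σ Bₒ + scal Complex.I * μ' * dot σ Eₒ * X) = 0 ∧
      antiherm (fwTransform 𝒳 ℋ 0 0) = 0 := by
  intro π Eₒ Bₒ μ' H ℋ u γ κ
  have hm' : (m : ℂ) ≠ 0 := by exact_mod_cast hm.ne'
  -- The Dirac Hamiltonian is the case of zero anomalous moment, so the general results are used
  -- twice, at μ'' and at 0.
  have hA0 : redA m 0 E = 0 := by rw [redA]; simp [mon]
  have hB0 : redB m 0 B = 0 := by rw [redB]; simp [mon]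
  have hH : H = pertH (mon m (-2)) (redU ħ m q P) (redV m q P) (redA m 0 E) (redB m 0 B) := by
    have hz : scal (0 : ℝ) = 0 := by rw [Complex.ofReal_zero, scal, map_zero]
    rw [← diracPauliH_eq hm 0, diracPauliH, hz, zero_mul, zero_smul, add_zero]
  have hℋ : ℋ = pertH (mon m (-2)) (redU ħ m q P) (redV m q P) (redA m μ'' E) (redB m μ'' B) :=
    diracPauliH_eq hm μ''
  have hμ : mon μ'' 1 = μ' := by
    change _ = scal _ * cinv
    rw [scal_eq_mon, cinv_eq_mon, mon_mul_mon, mul_one, zero_add]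
  have hκ : mon (q * ħ / (2 * m)) 1 = κ := by
    change _ = scal q * scal ħ * Ring.inverse (2 * scal m * c)
    rw [scal_eq_mon, scal_eq_mon, scal_eq_mon, two_mul_mon, c_eq_mon, mon_mul_mon, mon_mul_mon,
      inverse_mon (by simpa using hm'), mon_mul_mon, mul_one, div_eq_mul_inv]
    norm_num
  have hκ' : scal (ħ / 2) * (scal q * Ring.inverse (scal m * c)) = κ := by
    rw [← hκ, scal_eq_mon, scal_eq_mon, scal_eq_mon, c_eq_mon, mon_mul_mon,
      inverse_mon (by simpa using hm'), mon_mul_mon, mon_mul_mon]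
    congr 1
    field_simp
  have D := isPerturbation hP hm (ħ := ħ) (q := q) μ''
  have D₀ := isPerturbation hP hm (ħ := ħ) (q := q) 0
  have hγ := isPosSqrt_lorentz (P := P) (ħ := ħ) (q := q) hm
  have hDP := fwTransform_eq hP (ħ := ħ) (q := q) hm μ''
  have hDi := fwTransform_eq hP (ħ := ħ) (q := q) hm 0
  have hmon0 : mon ((0 : ℝ) : ℂ) 1 = 0 := by simp [mon]
  rw [hμ, hκ, ← hℋ] at hDP
  rw [hκ, ← hH, hmon0] at hDi
  have hsplit := D.fwTransform_sub hA0 hB0 D₀ (mon_comm m (-2))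
  have hk1 : mon m (-2) * redU ħ m q P = c * dot σ π := by
    rw [redU_eq hm, ← mul_assoc, mon_mul_mon, c_eq_mon, mul_inv_cancel₀ hm']
    norm_num [π]
  have hk2 : mon m (-2) * redB m μ'' B = μ' * dot σ Bₒ := by
    rw [redB, ← mul_assoc, mon_mul_mon, ← hμ, mul_div_cancel₀ _ hm']
    norm_num [Bₒ]
  have hk3 : mon m (-2) * redA m μ'' E = scal Complex.I * μ' * dot σ Eₒ := by
    rw [redA, ← mul_assoc, mon_mul_mon, ← hμ, mul_div_cancel₀ _ hm', scal_eq_mon, mon_mul_mon]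
    norm_num [Eₒ]
  rw [← hℋ, ← hH, hk1, hk2, hk3] at hsplit
  have hself : ∀ {X : Ser} {K : Mat}, matDag K = K →
      dag (fwTransform X K 0 0) = fwTransform X K 0 0 := fun {X K} h =>
    congrFun (congrFun (matDag_fwTransform X h) 0) 0
  have hHd := hself (X := gen (redU ħ m q P) (redV m q P) (redA m 0 E) (redB m 0 B))
    (hH ▸ matDag_pertH_red hm 0 : matDag H = H)
  have hℋd := hself (X := gen (redU ħ m q P) (redV m q P) (redA m μ'' E) (redB m μ'' B))
    (hℋ ▸ matDag_pertH_red hm μ'' : matDag ℋ = ℋ)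
  refine ⟨hγ, (isPosSqrt_kinetic hm).isPosSqrt_sqrt,
    gen (redU ħ m q P) (redV m q P) (redA m 0 E) (redB m 0 B),
    gen (redU ħ m q P) (redV m q P) (redA m μ'' E) (redB m μ'' B),
    fun X' => ?_, fun X' => ?_,
    ⟨fwU_mul_matDag D₀.ord_gen, matDag_mul_fwU D₀.ord_gen⟩,
    ⟨fwU_mul_matDag D.ord_gen, matDag_mul_fwU D.ord_gen⟩, ?_, ?_, hDP, fun g hg => ?_, hsplit,
    antiherm_eq_zero hHd, antiherm_eq_zero ?_, antiherm_eq_zero hℋd⟩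
  · rw [hH]
    exact isFW_red_iff hm hP 0 X'
  · rw [hℋ]
    exact isFW_red_iff hm hP μ'' X'
  · rw [hDi, dot_σ_spin_zero hγ.isUnit (isUnit_one_add_lorentz hm) (σ_comm_lorentz hm)
      fun x => hκ ▸ mon_comm _ _ x]
    abel
  · rw [hDi, classicalH_eq ħ m q _ 0 0 _ _ _ (mul_zero _), hκ']
  · rw [hDP, classicalH_eq ħ m q _ _ μ' _ _ _ ?_, hκ']
    change _ = scal μ'' * cinv
    rw [← mul_assoc, scal_mul, hg]
    push_cast
    rfl
  · have := hsplit
    rw [← sub_eq_iff_eq_add'] at this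
    rw [← this, dag_sub, hHd, hℋd]
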